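/- Let $d\ge 0$ and $k\geq 2$ be integers, let $p_k=\frac{2^k}{k+1}$, and let $s_k=\frac{2^k}{2^k-k-1}$ be its Hölder conjugate. All functions are measurable and real-valued on $\mathbb{R}^d$. The Gowers--Host--Kra norms are defined by $\|f\|_{U(1)}=\left|\int f\,dx\right|$ and $\|f\|_{U(j+1)}^{2^{j+1}}=\int_{\mathbb{R}^d}\|f^h\cdot f\|_{U(j)}^{2^j}\,dh$ for $j\geq 1$, where $f^h(x)=f(x+h)$. The dual function of $f$ is $$D_kf(x)=\int_{(\mathbb{R}^d)^k}\ \prod_{\alpha\in\{0,1\}^k\setminus\{0\}}f(x+\alpha_1h_1+\cdots+\alpha_kh_k)\,dh_1\cdots dh_k .$$ For $g\in L^{s_k}(\mathbb{R}^d)$ put $\|g\|_{U(k)}^*=\sup\{|\int gf\,dx| : f\in L^{p_k}(\mathbb{R}^d),\ \|f\|_{U(k)}\leq 1\}\in[0,\infty]$. Theorem. For every $g\in L^{s_k}(\mathbb{R}^d)$ with $\|g\|_{U(k)}^*=1$ and every $\delta>0$ there are functions $F\in L^{p_k}(\mathbb{R}^d)$ and $H\in L^{s_k}(\mathbb{R}^d)$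 such that the integral defining $D_kF(x)$ converges absolutely for almost every $x$, and $$g=D_kF+H\quad\text{almost everywhere},\qquad \|F\|_{U(k)}\leq 1,\qquad \|F\|_{p_k}\leq \frac1\delta,\qquad \|H\|_{s_k}\leq\delta .$$ -/

import Mathlib

open MeasureTheory
open scoped ENNReal

noncomputable section

/-- The exponent `p_k = 2^k / (k + 1)`. -/
def pExp (k : ℕ) : ℝ := 2 ^ k / ((k : ℝ) + 1)

/-- The exponent `s_k = 2^k / (2^k - k - 1)`, for `k ≥ 2` the Hölder conjugate of `p_k`. -/
def sExp (k : ℕ) : ℝ := 2 ^ k / (2 ^ k - (k : ℝ) - 1)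

/-- The Gowers-Host-Kra norm of a real function on `ℝ^d`, valued in `[0, ∞]`:
`‖f‖_{U(1)} = |∫ f|` and `‖f‖_{U(k+1)}^{2^(k+1)} = ∫ ‖f^h f‖_{U(k)}^{2^k} dh`, where
`f^h(x) = f(x + h)`. The value at index `0` is a placeholder that is never used. -/
def gowersNorm {d : ℕ} : ℕ → (EuclideanSpace ℝ (Fin d) → ℝ) → ℝ≥0∞
  | 0, _ => 0
  | 1, f => ‖∫ x, f x‖ₑ
  | k + 2, f =>
      (∫⁻ h : EuclideanSpace ℝ (Fin d),
        gowersNorm (k + 1) (fun x => f (x + h) * f x) ^ (2 ^ (k + 1) : ℕ)) ^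
          (1 / 2 ^ (k + 2) : ℝ)

/-- The product `∏ f(x + α · h)` over the nonzero vertices `α` of the cube `{0,1}^k`, where
`h = (h_1, …, h_k)` and `α · h = α_1 h_1 + ⋯ + α_k h_k`. -/
def cubeProd {d : ℕ} (k : ℕ) (f : EuclideanSpace ℝ (Fin d) → ℝ)
    (x : EuclideanSpace ℝ (Fin d)) (h : Fin k → EuclideanSpace ℝ (Fin d)) : ℝ :=
  ∏ α ∈ Finset.univ.erase (0 : Fin k → Fin 2), f (x + ∑ i, (α i : ℕ) • h i)

/-- The Gowers-Host-Kra dual function `D_k f(x) = ∫ ∏_{α ≠ 0} f(x + α · h) dh`. -/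
def dualFun {d : ℕ} (k : ℕ) (f : EuclideanSpace ℝ (Fin d) → ℝ)
    (x : EuclideanSpace ℝ (Fin d)) : ℝ :=
  ∫ h : Fin k → EuclideanSpace ℝ (Fin d), cubeProd k f x h

/-- The anti-uniform norm, valued in `[0, ∞]`: the supremum of `|⟨g, f⟩|` over all `f` in
`L^{p_k}` with `‖f‖_{U(k)} ≤ 1`. -/
def antiUniformNorm {d : ℕ} (k : ℕ) (g : EuclideanSpace ℝ (Fin d) → ℝ) : ℝ≥0∞ :=
  ⨆ (f : EuclideanSpace ℝ (Fin d) → ℝ)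
    (_ : MemLp f (ENNReal.ofReal (pExp k)) volume ∧ gowersNorm k f ≤ 1),
      ‖∫ x, g x * f x‖ₑ

end

/-! The decomposition is the Euler-Lagrange equation of a penalised dual problem. Write `T(w, f)`
for the integral of `w` times `D_k f`, so that `T(f, f)` is the `2^k`-th power of the `U(k)` norm,
and put `p = p_k`, `s = s_k`. A minimiser `F` over `L^p` of `T(f, f) / 2^k - ∫ g f + (δ^p / p) ∫
|f|^p` satisfies `g = D_k F + δ^p |F|^(p-2) F`, and the last term is `H`. Pairing this with `F` and
writing `v` for the `U(k)` norm of `F` gives `v^(2^k) + δ^p ∫ |F|^p = ∫ g F ≤ v`. Hence `v ≤ 1` and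
`δ^p ∫ |F|^p ≤ 1`, which yields all three bounds since `p s = p + s`.

Two facts about `T` carry the argument. The bound `lintegral_cubeIntegrand_le`, from Hölder and
Young, makes `T` finite and continuous in `w` on `L^p`. The inequality `IsTest.cubeForm_le`, `2^k
T(w, f) ≤ T(w, w) + (2^k - 1) T(f, f)`, says that the graph of `T(f, f)` lies above its tangents: it
gives midpoint convexity, lower semicontinuity and the variational inequality without
differentiating `T`.

The minimiser comes from uniform convexity of `∫ |f|^p`: minimising sequences are Cauchy in norm, so
no weak compactness is needed. -/

/-! ### Cube products and the recursion on the dimension of the cube. -/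

section CubeIntegrand

variable {d : ℕ}

local notation "𝔼" => EuclideanSpace ℝ (Fin d)

/-- The product of a function `w` with the translate of `f` by `h`. -/
def shiftMul (h : 𝔼) (f w : 𝔼 → ℝ) : 𝔼 → ℝ := fun x => f (x + h) * w x

/-- The product of `f` over all the vertices of a cube. -/
def cubeFull (k : ℕ) (f : 𝔼 → ℝ) (z : (Fin k → 𝔼) × 𝔼) : ℝ :=
  ∏ α : Fin k → Fin 2, f (z.2 + ∑ i, (α i : ℕ) • z.1 i)

/-- The product over the vertices of a cube of `f`, replaced by `w` at the base vertex. -/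
def cubeIntegrand (k : ℕ) (w f : 𝔼 → ℝ) (z : (Fin k → 𝔼) × 𝔼) : ℝ :=
  w z.2 * cubeProd k f z.2 z.1

/-- The pairing of `w` with the dual function of `f`, as an integral over all cubes. -/
noncomputable def cubeForm (k : ℕ) (w f : 𝔼 → ℝ) : ℝ :=
  ∫ z : (Fin k → 𝔼) × 𝔼, cubeIntegrand k w f z

theorem cubeIntegrand_self (k : ℕ) (f : 𝔼 → ℝ) : cubeIntegrand k f f = cubeFull k f := by
  funext z
  have := Finset.mul_prod_erase (Finset.univ : Finset (Fin k → Fin 2))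
    (fun α => f (z.2 + ∑ i, (α i : ℕ) • z.1 i)) (Finset.mem_univ 0)
  simp only [cubeIntegrand, cubeFull, cubeProd, ← this]
  simp

theorem cubeProd_eq_prod_ite (k : ℕ) (f : 𝔼 → ℝ) (x : 𝔼) (h : Fin k → 𝔼) :
    cubeProd k f x h =
      ∏ α : Fin k → Fin 2, if α = 0 then 1 else f (x + ∑ i, (α i : ℕ) • h i) := by
  rw [cubeProd, ← Finset.mul_prod_erase Finset.univ _ (Finset.mem_univ 0)]
  simp only [if_true, one_mul]
  refine Finset.prod_congr rfl fun α hα => ?_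
  rw [if_neg (Finset.ne_of_mem_erase hα)]

theorem prod_cube_succ {k : ℕ} (F : (Fin (k + 1) → Fin 2) → ℝ) :
    ∏ α, F α = (∏ β : Fin k → Fin 2, F (Fin.cons 0 β)) * ∏ β : Fin k → Fin 2, F (Fin.cons 1 β) := by
  rw [← (Fin.consEquiv (fun _ : Fin (k + 1) => Fin 2)).prod_comp, Fintype.prod_prod_type,
    Fin.prod_univ_two]
  rfl

theorem cubeFull_shift_mul (k : ℕ) (h₀ : 𝔼) (f w : 𝔼 → ℝ) (z : (Fin k → 𝔼) × 𝔼) :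
    cubeFull k (shiftMul h₀ f w) z = cubeFull k w z * cubeFull k f (z.1, z.2 + h₀) := by
  simp only [cubeFull, shiftMul, ← Finset.prod_mul_distrib]
  refine Finset.prod_congr rfl fun α _ => ?_
  rw [add_right_comm, mul_comm]

/-- Each vertex with first coordinate 0 is paired with its translate by `h₀`, which replaces `f` by
`f^{h₀} f`. Only the translate of the missing base vertex is left unpaired; it is the factor `f (x +
h₀)`. -/
theorem cubeProd_cons (k : ℕ) (f : 𝔼 → ℝ) (x h₀ : 𝔼) (h : Fin k → 𝔼) :
    cubeProd (k + 1) f x (Fin.cons h₀ h) = f (x + h₀) * cubeProd k (shiftMul h₀ f f) x h := by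
  have h1 (β : Fin k → Fin 2) : (Fin.cons 1 β : Fin (k + 1) → Fin 2) ≠ 0 := fun h => by
    simpa using congrFun h 0
  have h0 (β : Fin k → Fin 2) : (Fin.cons 0 β : Fin (k + 1) → Fin 2) = 0 ↔ β = 0 := by
    constructor
    · intro h
      funext i
      simpa using congrFun h i.succ
    · rintro rfl
      funext i
      refine Fin.cases ?_ (fun j => ?_) i <;> simp
  have hs : ∏ β : Fin k → Fin 2, f (x + h₀ + ∑ i, (β i : ℕ) • h i) =
      f (x + h₀) * cubeProd k f (x + h₀) h := by
    have := congrFun (cubeIntegrand_self k f) (h, x + h₀)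
    simpa [cubeFull, cubeIntegrand] using this.symm
  rw [cubeProd_eq_prod_ite, prod_cube_succ]
  simp only [h1, h0, if_false, Fin.sum_univ_succ, Fin.cons_zero, Fin.cons_succ]
  simp only [Fin.val_zero, zero_smul, zero_add, Fin.val_one, one_smul, ← add_assoc]
  rw [hs, ← cubeProd_eq_prod_ite, mul_left_comm]
  congr 1
  simp only [cubeProd, ← Finset.prod_mul_distrib, shiftMul]
  refine Finset.prod_congr rfl fun α _ => ?_
  rw [mul_comm, add_right_comm]

theorem cubeIntegrand_cons (k : ℕ) (w f : 𝔼 → ℝ) (x h₀ : 𝔼) (h : Fin k → 𝔼) :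
    cubeIntegrand (k + 1) w f (Fin.cons h₀ h, x) =
      cubeIntegrand k (shiftMul h₀ f w) (shiftMul h₀ f f) (h, x) := by
  simp only [cubeIntegrand, cubeProd_cons, shiftMul]
  ring

theorem cubeProd_zero (f : 𝔼 → ℝ) (x : 𝔼) (h : Fin 0 → 𝔼) : cubeProd 0 f x h = 1 := by
  rw [cubeProd_eq_prod_ite]
  refine Finset.prod_eq_one fun α _ => ?_
  rw [if_pos (Subsingleton.elim _ _)]

/-- Splitting off the first side of a cube. -/
noncomputable def cubeConsEquiv (d k : ℕ) : EuclideanSpace ℝ (Fin d) ×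
    ((Fin k → EuclideanSpace ℝ (Fin d)) × EuclideanSpace ℝ (Fin d)) ≃ᵐ
      (Fin (k + 1) → EuclideanSpace ℝ (Fin d)) × EuclideanSpace ℝ (Fin d) :=
  MeasurableEquiv.prodAssoc.symm.trans
    ((MeasurableEquiv.piFinSuccAbove (fun _ => EuclideanSpace ℝ (Fin d)) 0).symm.prodCongr
      (MeasurableEquiv.refl _))

theorem cubeConsEquiv_apply (k : ℕ) (h₀ : 𝔼) (h : Fin k → 𝔼) (x : 𝔼) :
    cubeConsEquiv d k (h₀, (h, x)) = (Fin.cons h₀ h, x) := by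
  simp [cubeConsEquiv, MeasurableEquiv.prodCongr, MeasurableEquiv.prodAssoc,
    MeasurableEquiv.piFinSuccAbove]
  rfl

theorem measurePreserving_cubeConsEquiv (d k : ℕ) :
    MeasurePreserving (cubeConsEquiv d k) volume volume :=
  (volume_preserving_prodAssoc.symm).trans
    (((volume_preserving_piFinSuccAbove (fun _ => EuclideanSpace ℝ (Fin d)) 0).symm).prod
      (MeasurePreserving.id _))

theorem cubeIntegrand_cubeConsEquiv (k : ℕ) (w f : 𝔼 → ℝ) (h₀ : 𝔼) (z : (Fin k → 𝔼) × 𝔼) :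
    cubeIntegrand (k + 1) w f (cubeConsEquiv d k (h₀, z)) =
      cubeIntegrand k (shiftMul h₀ f w) (shiftMul h₀ f f) z := by
  rw [← cubeIntegrand_cons, ← cubeConsEquiv_apply]

theorem cubeForm_succ {k : ℕ} {w f : 𝔼 → ℝ} (hi : Integrable (cubeIntegrand (k + 1) w f)) :
    cubeForm (k + 1) w f = ∫ h, cubeForm k (shiftMul h f w) (shiftMul h f f) := by
  have hp := measurePreserving_cubeConsEquiv d k
  rw [cubeForm, ← hp.integral_comp', Measure.volume_eq_prod, integral_prod]
  · simp only [cubeIntegrand_cubeConsEquiv, cubeForm]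
  · exact hp.integrable_comp_of_integrable hi

theorem integrable_cubeForm_shiftMul {k : ℕ} {w f : 𝔼 → ℝ}
    (hi : Integrable (cubeIntegrand (k + 1) w f)) :
    Integrable fun h => cubeForm k (shiftMul h f w) (shiftMul h f f) := by
  have h := ((measurePreserving_cubeConsEquiv d k).integrable_comp_of_integrable hi)
  have h' := h.integral_prod_left
  simpa only [Function.comp_apply, cubeIntegrand_cubeConsEquiv, cubeForm] using h'

theorem lintegral_cubeIntegrand_succ {k : ℕ} {w f : 𝔼 → ℝ} (G : ℝ → ℝ≥0∞) (hG : Measurable G)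
    (hi : Measurable (cubeIntegrand (k + 1) w f)) :
    ∫⁻ z, G (cubeIntegrand (k + 1) w f z) =
      ∫⁻ h, ∫⁻ z, G (cubeIntegrand k (shiftMul h f w) (shiftMul h f f) z) := by
  have hp := measurePreserving_cubeConsEquiv d k
  rw [← hp.lintegral_comp (f := fun z => G (cubeIntegrand (k + 1) w f z)) (hG.comp hi),
    Measure.volume_eq_prod, lintegral_prod]
  · simp only [cubeIntegrand_cubeConsEquiv]
  · exact ((hG.comp hi).comp hp.measurable).aemeasurable

theorem measurable_cubeProd {k : ℕ} {f : 𝔼 → ℝ} (hf : Measurable f) :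
    Measurable fun z : (Fin k → 𝔼) × 𝔼 => cubeProd k f z.2 z.1 := by
  unfold cubeProd
  fun_prop

theorem measurable_cubeIntegrand {k : ℕ} {w f : 𝔼 → ℝ} (hw : Measurable w) (hf : Measurable f) :
    Measurable (cubeIntegrand k w f) :=
  (hw.comp measurable_snd).mul (measurable_cubeProd hf)

theorem measurable_shiftMul {f w : 𝔼 → ℝ} (hf : Measurable f) (hw : Measurable w) (h : 𝔼) :
    Measurable (shiftMul h f w) := by
  unfold shiftMul
  fun_prop

theorem measurable_uncurry_shiftMul {f w : 𝔼 → ℝ} (hf : Measurable f) (hw : Measurable w) :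
    Measurable fun q : 𝔼 × 𝔼 => shiftMul q.1 f w q.2 := by
  unfold shiftMul
  fun_prop

theorem volume_univ_pi_fin_zero (d : ℕ) :
    (volume : Measure (Fin 0 → EuclideanSpace ℝ (Fin d))) Set.univ = 1 := by
  rw [volume_pi, Measure.pi_empty_univ]

theorem integral_cube_zero (f : 𝔼 → ℝ) :
    ∫ z : (Fin 0 → 𝔼) × 𝔼, f z.2 = ∫ x, f x := by
  have := integral_prod_mul (μ := (volume : Measure (Fin 0 → 𝔼))) (ν := (volume : Measure 𝔼))
    (fun _ => (1 : ℝ)) f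
  simpa [Measure.volume_eq_prod, Measure.real, volume_univ_pi_fin_zero] using this

theorem cubeForm_zero (w f : 𝔼 → ℝ) : cubeForm 0 w f = ∫ x, w x := by
  simp only [cubeForm, cubeIntegrand, cubeProd_zero, mul_one]
  exact integral_cube_zero w

theorem lintegral_cubeIntegrand_zero {w f : 𝔼 → ℝ} (hw : Measurable w) :
    ∫⁻ z, ‖cubeIntegrand 0 w f z‖ₑ = ∫⁻ x, ‖w x‖ₑ := by
  simp only [cubeIntegrand, cubeProd_zero, mul_one]
  rw [Measure.volume_eq_prod, lintegral_prod]
  · simp [volume_univ_pi_fin_zero]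
  · fun_prop

end CubeIntegrand

/-! ### Absolute convergence of cube integrals on `L^{p_k}`. -/

section Bounds

variable {d : ℕ}

local notation "𝔼" => EuclideanSpace ℝ (Fin d)

theorem lintegral_lintegral_shift_mul {a b : 𝔼 → ℝ≥0∞} (ha : Measurable a) (hb : Measurable b) :
    ∫⁻ h, ∫⁻ x, b (x + h) * a x = (∫⁻ x, a x) * ∫⁻ x, b x := by
  rw [lintegral_lintegral_swap (by fun_prop)]
  have (x : 𝔼) : ∫⁻ h, b (x + h) * a x = (∫⁻ y, b y) * a x := by
    rw [lintegral_mul_const _ (by fun_prop), lintegral_add_left_eq_self]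
  simp only [this]
  rw [lintegral_const_mul _ ha, mul_comm]

/-- A case of Young's convolution inequality, proved by Hölder's inequality. -/
theorem lintegral_lintegral_shift_rpow_le {a b : 𝔼 → ℝ≥0∞} (ha : Measurable a)
    (hb : Measurable b) (k : ℕ) :
    ∫⁻ h, (∫⁻ x, (b (x + h) * a x) ^ (((k : ℝ) + 2) / (2 * (k + 1)))) ^ ((k : ℝ) + 1) ≤
      ((∫⁻ x, a x) * ∫⁻ x, b x) ^ (((k : ℝ) + 2) / 2) := by
  set A := ∫⁻ x, a x
  set B := ∫⁻ x, b x
  have hk : (0 : ℝ) < k + 1 := by positivity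
  -- Hölder with three factors `b^h a`, `a`, `b^h`. The weight `1 / (k + 1)` on the first is chosen
  -- so that the outer power `k + 1` makes it linear, after which Fubini evaluates the integral over
  -- `h`.
  have key (h : 𝔼) : ∫⁻ x, (b (x + h) * a x) ^ (((k : ℝ) + 2) / (2 * (k + 1))) ≤
      (∫⁻ x, b (x + h) * a x) ^ (1 / ((k : ℝ) + 1)) * (A * B) ^ ((k : ℝ) / (2 * (k + 1))) := by
    have hH := ENNReal.lintegral_prod_norm_pow_le (μ := (volume : Measure 𝔼)) Finset.univ
      (f := ![fun x => b (x + h) * a x, a, fun x => b (x + h)])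
      (p := ![1 / ((k : ℝ) + 1), (k : ℝ) / (2 * (k + 1)), (k : ℝ) / (2 * (k + 1))])
      (by intro i _; fin_cases i <;> simp <;> fun_prop)
      (by simp [Fin.sum_univ_three]; field_simp; ring)
      (by intro i _; fin_cases i <;> simp <;> positivity)
    simp only [Fin.prod_univ_three, Matrix.cons_val_zero, Matrix.cons_val_one, Matrix.cons_val]
      at hH
    rw [lintegral_add_right_eq_self b h, mul_assoc, ← ENNReal.mul_rpow_of_nonneg _ _
      (by positivity)] at hH
    refine le_trans (le_of_eq ?_) hH
    refine lintegral_congr fun x => ?_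
    rw [mul_assoc, ← ENNReal.mul_rpow_of_nonneg _ _ (by positivity), mul_comm (a x),
      ← ENNReal.rpow_add_of_nonneg _ _ (by positivity) (by positivity)]
    congr 1
    field_simp
    ring
  calc _ ≤ ∫⁻ h, (∫⁻ x, b (x + h) * a x) * (A * B) ^ ((k : ℝ) / 2) := by
        refine lintegral_mono fun h => ?_
        refine (ENNReal.rpow_le_rpow (key h) hk.le).trans (le_of_eq ?_)
        rw [ENNReal.mul_rpow_of_nonneg _ _ hk.le, ← ENNReal.rpow_mul, ← ENNReal.rpow_mul]
        have h1 : 1 / ((k : ℝ) + 1) * (k + 1) = 1 := by field_simp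
        have h2 : (k : ℝ) / (2 * (k + 1)) * (k + 1) = k / 2 := by field_simp
        rw [h1, h2, ENNReal.rpow_one]
    _ = _ := by
        rw [lintegral_mul_const _ (by fun_prop), lintegral_lintegral_shift_mul ha hb]
        nth_rw 1 [← ENNReal.rpow_one (A * B)]
        rw [← ENNReal.rpow_add_of_nonneg _ _ (by positivity) (by positivity)]
        congr 1
        ring

theorem pExp_pos (k : ℕ) : 0 < pExp k := by
  unfold pExp
  positivity

theorem pExp_succ (k : ℕ) :
    pExp k = pExp (k + 1) * (((k : ℝ) + 2) / (2 * (k + 1))) := by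
  unfold pExp
  push_cast
  field_simp
  ring

/-- The `L^{p_k}` norm of products with translates, averaged over the translates. -/
theorem lintegral_eLpNorm'_shiftMul_pow_le (k : ℕ) {f w : 𝔼 → ℝ} (hf : Measurable f)
    (hw : Measurable w) :
    ∫⁻ h, eLpNorm' (shiftMul h f w) (pExp k) volume ^ (2 ^ k) ≤
      (eLpNorm' w (pExp (k + 1)) volume * eLpNorm' f (pExp (k + 1)) volume) ^ (2 ^ k) := by
  -- With these `a` and `b` the inner exponent becomes `p_k`, and the outer one is `k + 1 = 2^k /
  -- p_k`.
  have h0 := lintegral_lintegral_shift_rpow_le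
    (a := fun x => ‖w x‖ₑ ^ pExp (k + 1)) (b := fun x => ‖f x‖ₑ ^ pExp (k + 1))
    (by fun_prop) (by fun_prop) k
  refine le_trans (le_of_eq ?_) (h0.trans (le_of_eq ?_))
  · refine lintegral_congr fun h => ?_
    rw [eLpNorm', ← ENNReal.rpow_natCast, ← ENNReal.rpow_mul]
    congr 1
    · refine lintegral_congr fun x => ?_
      rw [shiftMul, enorm_mul, ← ENNReal.mul_rpow_of_nonneg _ _ (pExp_pos _).le,
        ← ENNReal.rpow_mul, ← pExp_succ]
    · unfold pExp
      push_cast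
      field_simp
  · rw [eLpNorm', eLpNorm', ← ENNReal.mul_rpow_of_nonneg _ _ (by have := pExp_pos (k+1); positivity),
      ← ENNReal.rpow_natCast, ← ENNReal.rpow_mul]
    congr 1
    unfold pExp
    push_cast
    field_simp
    ring

theorem measurable_eLpNorm'_shiftMul {f w : 𝔼 → ℝ} (hf : Measurable f) (hw : Measurable w)
    (q : ℝ) : Measurable fun h => eLpNorm' (shiftMul h f w) q volume := by
  unfold eLpNorm'
  have := measurable_uncurry_shiftMul hf hw
  refine Measurable.pow_const (Measurable.lintegral_prod_right' (f := fun z : 𝔼 × 𝔼 =>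
    ‖shiftMul z.1 f w z.2‖ₑ ^ q) ?_) _
  fun_prop

/-- Induction on `k`, starting from `p_0 = 1`. Fix the first side `h`, apply the previous case to `w
f^h` and `f f^h`, use Hölder in `h` with weights `1 / 2^k` and `1 - 1 / 2^k`, then the averaged
bound for products with translates. -/
theorem lintegral_cubeIntegrand_le (k : ℕ) {w f : 𝔼 → ℝ} (hw : Measurable w)
    (hf : Measurable f) :
    ∫⁻ z, ‖cubeIntegrand k w f z‖ₑ ≤
      eLpNorm' w (pExp k) volume * eLpNorm' f (pExp k) volume ^ (2 ^ k - 1) := by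
  induction k generalizing w f with
  | zero => simp [lintegral_cubeIntegrand_zero hw, eLpNorm', pExp]
  | succ k ih =>
    set X := eLpNorm' w (pExp (k + 1)) volume
    set Y := eLpNorm' f (pExp (k + 1)) volume
    have hN : (1 : ℕ) ≤ 2 ^ k := Nat.one_le_two_pow
    have hN' : (1 : ℝ) ≤ 2 ^ k := one_le_pow₀ (by norm_num)
    rw [lintegral_cubeIntegrand_succ _ measurable_enorm (measurable_cubeIntegrand hw hf)]
    have hr (t : ℝ≥0∞) : (t ^ (2 ^ k)) ^ (1 / 2 ^ k : ℝ) = t := by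
      rw [← ENNReal.rpow_natCast, ← ENNReal.rpow_mul]
      simp
    have hr' (t : ℝ≥0∞) : (t ^ (2 ^ k)) ^ (1 - 1 / 2 ^ k : ℝ) = t ^ (2 ^ k - 1) := by
      rw [← ENNReal.rpow_natCast, ← ENNReal.rpow_mul, ← ENNReal.rpow_natCast]
      congr 1
      push_cast [hN]
      field_simp
    have hle : (1 / 2 ^ k : ℝ) ≤ 1 := by
      rw [div_le_one (by positivity)]
      exact hN'
    calc _ ≤ ∫⁻ h, eLpNorm' (shiftMul h f w) (pExp k) volume *
          eLpNorm' (shiftMul h f f) (pExp k) volume ^ (2 ^ k - 1) :=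
          lintegral_mono fun h => ih (measurable_shiftMul hf hw h) (measurable_shiftMul hf hf h)
      _ = ∫⁻ h, (eLpNorm' (shiftMul h f w) (pExp k) volume ^ (2 ^ k)) ^ (1 / 2 ^ k : ℝ) *
          (eLpNorm' (shiftMul h f f) (pExp k) volume ^ (2 ^ k)) ^ (1 - 1 / 2 ^ k : ℝ) := by
          simp only [hr, hr']
      _ ≤ (∫⁻ h, eLpNorm' (shiftMul h f w) (pExp k) volume ^ (2 ^ k)) ^ (1 / 2 ^ k : ℝ) *
          (∫⁻ h, eLpNorm' (shiftMul h f f) (pExp k) volume ^ (2 ^ k)) ^ (1 - 1 / 2 ^ k : ℝ) :=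
          ENNReal.lintegral_mul_norm_pow_le
            ((measurable_eLpNorm'_shiftMul hf hw _).pow_const _).aemeasurable
            ((measurable_eLpNorm'_shiftMul hf hf _).pow_const _).aemeasurable
            (by positivity) (sub_nonneg.2 hle) (by ring)
      _ ≤ ((X * Y) ^ (2 ^ k)) ^ (1 / 2 ^ k : ℝ) * ((Y * Y) ^ (2 ^ k)) ^ (1 - 1 / 2 ^ k : ℝ) := by
          refine mul_le_mul' (ENNReal.rpow_le_rpow (lintegral_eLpNorm'_shiftMul_pow_le k hf hw)
            (by positivity)) (ENNReal.rpow_le_rpow (lintegral_eLpNorm'_shiftMul_pow_le k hf hf)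
            (sub_nonneg.2 hle))
      _ = X * Y ^ (2 ^ (k + 1) - 1) := by
          rw [hr, hr', mul_assoc, ← pow_two, ← pow_mul, ← pow_succ']
          congr 2
          rw [pow_succ]
          omega

/-- A measurable function in `L^{p_k}`. -/
structure IsTest (k : ℕ) (f : 𝔼 → ℝ) : Prop where
  measurable : Measurable f
  eLpNorm'_lt_top : eLpNorm' f (pExp k) volume < ∞

theorem IsTest.integrable_cubeIntegrand {k : ℕ} {w f : 𝔼 → ℝ} (hw : IsTest k w)
    (hf : IsTest k f) : Integrable (cubeIntegrand k w f) := by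
  refine ⟨(measurable_cubeIntegrand hw.1 hf.1).aestronglyMeasurable, ?_⟩
  exact (lintegral_cubeIntegrand_le k hw.1 hf.1).trans_lt
    (ENNReal.mul_lt_top hw.2 (ENNReal.pow_lt_top hf.2))

theorem IsTest.ae_shiftMul {k : ℕ} {w f : 𝔼 → ℝ} (hw : IsTest (k + 1) w)
    (hf : IsTest (k + 1) f) : ∀ᵐ h, IsTest k (shiftMul h f w) := by
  have h := lintegral_eLpNorm'_shiftMul_pow_le k hf.1 hw.1
  have hlt := h.trans_lt (ENNReal.pow_lt_top (ENNReal.mul_lt_top hw.2 hf.2))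
  filter_upwards [ae_lt_top ((measurable_eLpNorm'_shiftMul hf.1 hw.1 _).pow_const _) hlt.ne]
    with h hh
  refine ⟨measurable_shiftMul hf.1 hw.1 h, ?_⟩
  rw [lt_top_iff_ne_top] at hh ⊢
  contrapose! hh
  rw [hh, ENNReal.top_pow (by positivity)]

end Bounds

/-! ### Positivity, Gowers-Cauchy-Schwarz and the link with the Gowers norm. -/

section GowersCauchySchwarz

variable {d : ℕ}

local notation "𝔼" => EuclideanSpace ℝ (Fin d)

theorem measurable_cubeFull {k : ℕ} {f : 𝔼 → ℝ} (hf : Measurable f) :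
    Measurable (cubeFull k f) := by
  rw [← cubeIntegrand_self]
  exact measurable_cubeIntegrand hf hf

theorem IsTest.integrable_cubeFull_shiftMul {k : ℕ} {w f : 𝔼 → ℝ} (hw : IsTest (k + 1) w)
    (hf : IsTest (k + 1) f) :
    Integrable fun q : 𝔼 × ((Fin k → 𝔼) × 𝔼) => cubeFull k (shiftMul q.1 f w) q.2 := by
  have hm : Measurable fun q : 𝔼 × ((Fin k → 𝔼) × 𝔼) => cubeFull k (shiftMul q.1 f w) q.2 := by
    simp only [cubeFull_shift_mul]
    have h1 := measurable_cubeFull (k := k) hw.1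
    have h2 := measurable_cubeFull (k := k) hf.1
    fun_prop
  refine ⟨hm.aestronglyMeasurable, ?_⟩
  have h := lintegral_eLpNorm'_shiftMul_pow_le k hf.1 hw.1
  rw [HasFiniteIntegral, Measure.volume_eq_prod, lintegral_prod _ hm.enorm.aemeasurable]
  refine lt_of_le_of_lt (lintegral_mono fun h₀ => ?_)
    (h.trans_lt (ENNReal.pow_lt_top (ENNReal.mul_lt_top hw.2 hf.2)))
  have := measurable_shiftMul hf.1 hw.1 h₀
  have hle := lintegral_cubeIntegrand_le k this this
  rw [cubeIntegrand_self, mul_comm, pow_sub_one_mul (by positivity)] at hle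
  exact hle

/-- The change of variables `(h₀, (h, x)) ↦ (h, (x, x + h₀))`. -/
theorem measurePreserving_cube_regroup (d k : ℕ) :
    MeasurePreserving (fun q : EuclideanSpace ℝ (Fin d) ×
      ((Fin k → EuclideanSpace ℝ (Fin d)) × EuclideanSpace ℝ (Fin d)) =>
        (q.2.1, (q.2.2, q.2.2 + q.1))) volume volume :=
  (((MeasurePreserving.id _).prod (measurePreserving_prod_add volume volume)).comp
    (volume_preserving_prodAssoc (α₁ := Fin k → EuclideanSpace ℝ (Fin d)))).comp
      Measure.measurePreserving_swap

/-- The integral of the cube product over the base point. -/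
noncomputable def cubeMean (k : ℕ) (f : 𝔼 → ℝ) (h : Fin k → 𝔼) : ℝ := ∫ x, cubeFull k f (h, x)

theorem IsTest.integrable_cubeFull_mul {k : ℕ} {w f : 𝔼 → ℝ} (hw : IsTest (k + 1) w)
    (hf : IsTest (k + 1) f) :
    Integrable fun r : (Fin k → 𝔼) × (𝔼 × 𝔼) =>
      cubeFull k w (r.1, r.2.1) * cubeFull k f (r.1, r.2.2) := by
  have hm : Measurable fun r : (Fin k → 𝔼) × (𝔼 × 𝔼) =>
      cubeFull k w (r.1, r.2.1) * cubeFull k f (r.1, r.2.2) := by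
    have h1 := measurable_cubeFull (k := k) hw.1
    have h2 := measurable_cubeFull (k := k) hf.1
    fun_prop
  have hp := measurePreserving_cube_regroup d k
  rw [← hp.integrable_comp hm.aestronglyMeasurable]
  have := hw.integrable_cubeFull_shiftMul hf
  simp only [cubeFull_shift_mul] at this
  exact this

theorem IsTest.integrable_cubeMean_mul {k : ℕ} {w f : 𝔼 → ℝ} (hw : IsTest (k + 1) w)
    (hf : IsTest (k + 1) f) : Integrable fun h => cubeMean k w h * cubeMean k f h := by
  have := (hw.integrable_cubeFull_mul hf).integral_prod_left
  refine this.congr (Filter.Eventually.of_forall fun h => ?_)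
  exact integral_prod_mul (fun x => cubeFull k w (h, x)) (fun y => cubeFull k f (h, y))

theorem IsTest.integrable_cubeForm_shiftMul_self {k : ℕ} {w f : 𝔼 → ℝ} (hw : IsTest (k + 1) w)
    (hf : IsTest (k + 1) f) :
    Integrable fun h => cubeForm k (shiftMul h f w) (shiftMul h f w) := by
  simp only [cubeForm, cubeIntegrand_self]
  exact (hw.integrable_cubeFull_shiftMul hf).integral_prod_left

/-- A `(k+1)`-cube is a pair of parallel `k`-cubes. In the variables `x` and `y = x + h₀` their base
points are independent, so the integral factors for fixed sides. For `w = f` this is a square,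
whence positivity. -/
theorem IsTest.integral_cubeForm_shiftMul_self {k : ℕ} {w f : 𝔼 → ℝ} (hw : IsTest (k + 1) w)
    (hf : IsTest (k + 1) f) :
    ∫ h, cubeForm k (shiftMul h f w) (shiftMul h f w) = ∫ h, cubeMean k w h * cubeMean k f h := by
  have hG := hw.integrable_cubeFull_mul hf
  have hp := measurePreserving_cube_regroup d k
  simp only [cubeForm, cubeIntegrand_self]
  have h1 := integral_prod _ (hw.integrable_cubeFull_shiftMul hf)
  have h2 := integral_prod _ hG
  have h3 := integral_map hp.measurable.aemeasurable
    (hp.map_eq.symm ▸ hG.aestronglyMeasurable)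
  rw [hp.map_eq] at h3
  simp only [cubeFull_shift_mul] at h1 ⊢
  rw [← h1]
  refine h3.symm.trans (h2.trans (integral_congr_ae (Filter.Eventually.of_forall fun h => ?_)))
  exact integral_prod_mul (fun x => cubeFull k w (h, x)) (fun y => cubeFull k f (h, y))

theorem IsTest.cubeForm_self_succ {k : ℕ} {f : 𝔼 → ℝ} (hf : IsTest (k + 1) f) :
    cubeForm (k + 1) f f = ∫ h, cubeMean k f h * cubeMean k f h := by
  rw [cubeForm_succ (hf.integrable_cubeIntegrand hf), hf.integral_cubeForm_shiftMul_self hf]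

theorem IsTest.cubeForm_self_nonneg {k : ℕ} {f : 𝔼 → ℝ} (hf : IsTest (k + 1) f) :
    0 ≤ cubeForm (k + 1) f f := by
  rw [hf.cubeForm_self_succ]
  exact integral_nonneg fun h => mul_self_nonneg _

/-- The Gowers-Cauchy-Schwarz inequality for a cube with one distinguished vertex, in the form
obtained from it by the inequality of arithmetic and geometric means. -/
theorem IsTest.cubeForm_le {k : ℕ} {w f : 𝔼 → ℝ} (hw : IsTest k w) (hf : IsTest k f) :
    2 ^ k * cubeForm k w f ≤ cubeForm k w w + (2 ^ k - 1) * cubeForm k f f := by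
  induction k generalizing w f with
  | zero => simp [cubeForm_zero]
  | succ k ih =>
    have h1 := integrable_cubeForm_shiftMul (hw.integrable_cubeIntegrand hf)
    have h2 := hw.integrable_cubeForm_shiftMul_self hf
    have h3 := hf.integrable_cubeForm_shiftMul_self hf
    -- The induction hypothesis on each slice handles all directions but the first; a mixed term in
    -- `w f^h` remains.
    have h4 : ∫ h, 2 ^ k * cubeForm k (shiftMul h f w) (shiftMul h f f) ≤
        ∫ h, (cubeForm k (shiftMul h f w) (shiftMul h f w) +
          (2 ^ k - 1) * cubeForm k (shiftMul h f f) (shiftMul h f f)) := by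
      refine integral_mono_ae (h1.const_mul _) (h2.add (h3.const_mul _)) ?_
      filter_upwards [hw.ae_shiftMul hf, hf.ae_shiftMul hf] with h hw' hf'
      exact ih hw' hf'
    rw [integral_add h2 (h3.const_mul _), integral_const_mul, integral_const_mul,
      ← cubeForm_succ (hw.integrable_cubeIntegrand hf),
      ← cubeForm_succ (hf.integrable_cubeIntegrand hf),
      hw.integral_cubeForm_shiftMul_self hf] at h4
    have hW := hw.integrable_cubeMean_mul hw
    have hF := hf.integrable_cubeMean_mul hf
    -- The mixed term is an inner product of cube means, so `2ab ≤ a² + b²` separates `w` from `f`.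
    -- Doubling the previous bound then produces the coefficient `2^(k+1) - 1`.
    have h5 : ∫ h, cubeMean k w h * cubeMean k f h ≤
        ∫ h, (1 / 2 * (cubeMean k w h * cubeMean k w h) +
          1 / 2 * (cubeMean k f h * cubeMean k f h)) := by
      refine integral_mono (hw.integrable_cubeMean_mul hf)
        ((hW.const_mul _).add (hF.const_mul _)) fun h => ?_
      dsimp only
      nlinarith [sq_nonneg (cubeMean k w h - cubeMean k f h)]
    rw [integral_add (hW.const_mul _) (hF.const_mul _), integral_const_mul, integral_const_mul,
      ← hw.cubeForm_self_succ, ← hf.cubeForm_self_succ] at h5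
    rw [pow_succ]
    linarith

theorem cubeMean_zero (f : 𝔼 → ℝ) (h : Fin 0 → 𝔼) : cubeMean 0 f h = ∫ x, f x := by
  simp [cubeMean, cubeFull]

/-- The recursion of the norm matches that of the cube form; positivity of almost every slice lets
`ENNReal.ofReal` pass through the integral. The index starts at 1 because the norm at 0 is a
placeholder. -/
theorem IsTest.gowersNorm_pow {k : ℕ} {f : 𝔼 → ℝ} (hf : IsTest (k + 1) f) :
    gowersNorm (k + 1) f ^ (2 ^ (k + 1)) = ENNReal.ofReal (cubeForm (k + 1) f f) := by
  induction k generalizing f with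
  | zero =>
    have h : cubeForm (0 + 1) f f = ‖∫ x, f x‖ ^ 2 := by
      rw [hf.cubeForm_self_succ]
      simp only [cubeMean_zero]
      simp [Measure.real, volume_univ_pi_fin_zero, pow_two]
    rw [h, ENNReal.ofReal_pow (norm_nonneg _), ofReal_norm]
    rfl
  | succ k ih =>
    have hI := hf.integrable_cubeIntegrand hf
    rw [gowersNorm, ← ENNReal.rpow_natCast, ← ENNReal.rpow_mul, cubeForm_succ hI]
    have h1 : (1 / 2 ^ (k + 2) : ℝ) * ((2 ^ (k + 1 + 1) : ℕ) : ℝ) = 1 := by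
      push_cast
      field_simp
    rw [h1, ENNReal.rpow_one, ofReal_integral_eq_lintegral_ofReal (integrable_cubeForm_shiftMul hI)]
    · refine lintegral_congr_ae ?_
      filter_upwards [hf.ae_shiftMul hf] with h hh
      exact ih hh
    · filter_upwards [hf.ae_shiftMul hf] with h hh
      exact hh.cubeForm_self_nonneg

end GowersCauchySchwarz

/-! ### Uniform convexity and existence of minimisers. -/

section Minimizer

open Filter Topology

/-- The failure of midpoint linearity of `|x| ^ p`. -/
noncomputable def rpowDefect (p a b : ℝ) : ℝ := (|a| ^ p + |b| ^ p) / 2 - |(a + b) / 2| ^ p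

theorem rpowDefect_nonneg {p : ℝ} (hp : 1 < p) (a b : ℝ) : 0 ≤ rpowDefect p a b := by
  have h := (convexOn_rpow hp.le).2 (abs_nonneg a) (abs_nonneg b)
    (by norm_num : (0 : ℝ) ≤ 1 / 2) (by norm_num : (0 : ℝ) ≤ 1 / 2) (by norm_num)
  have h1 : |(a + b) / 2| ≤ 1 / 2 * |a| + 1 / 2 * |b| := by
    rw [abs_div, abs_two]
    linarith [abs_add_le a b]
  have h2 := Real.rpow_le_rpow (abs_nonneg _) h1 (by linarith : 0 ≤ p)
  simp only [smul_eq_mul] at h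
  unfold rpowDefect
  linarith

theorem rpowDefect_pos {p : ℝ} (hp : 1 < p) {a b : ℝ} (hab : a ≠ b) : 0 < rpowDefect p a b := by
  have hp0 : 0 < p := by linarith
  unfold rpowDefect
  by_cases h : |a| = |b|
  · obtain rfl : a = -b := (abs_eq_abs.1 h).resolve_left hab
    have hb : b ≠ 0 := by
      rintro rfl
      simp at hab
    have : 0 < |b| ^ p := Real.rpow_pos_of_pos (abs_pos.2 hb) _
    simp [Real.zero_rpow hp0.ne', this]
  · have h' := (strictConvexOn_rpow hp).2 (abs_nonneg a) (abs_nonneg b) h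
      (by norm_num : (0 : ℝ) < 1 / 2) (by norm_num : (0 : ℝ) < 1 / 2) (by norm_num)
    have h1 : |(a + b) / 2| ≤ 1 / 2 * |a| + 1 / 2 * |b| := by
      rw [abs_div, abs_two]
      linarith [abs_add_le a b]
    have h2 := Real.rpow_le_rpow (abs_nonneg _) h1 hp0.le
    simp only [smul_eq_mul] at h'
    linarith

theorem rpowDefect_mul {p t : ℝ} (ht : 0 ≤ t) (a b : ℝ) :
    rpowDefect p (t * a) (t * b) = t ^ p * rpowDefect p a b := by
  unfold rpowDefect
  rw [← mul_add, mul_div_assoc, abs_mul, abs_mul, abs_mul, abs_of_nonneg ht,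
    Real.mul_rpow ht (abs_nonneg _), Real.mul_rpow ht (abs_nonneg _),
    Real.mul_rpow ht (abs_nonneg _)]
  ring

/-- A quantitative form of the strict convexity of `|x| ^ p`. -/
theorem exists_abs_sub_rpow_le {p : ℝ} (hp : 1 < p) {η : ℝ} (hη : 0 < η) :
    ∃ C, 0 ≤ C ∧ ∀ a b : ℝ,
      |a - b| ^ p ≤ η * (|a| ^ p + |b| ^ p) + C * rpowDefect p a b := by
  have hp0 : 0 < p := by linarith
  have hc (F : ℝ × ℝ → ℝ) (hF : Continuous F) : Continuous fun q => |F q| ^ p :=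
    hF.abs.rpow_const fun _ => Or.inr hp0.le
  -- Normalised pairs for which the `η` term alone does not suffice. The defect is positive and
  -- continuous on this compact set, hence bounded below there; homogeneity extends the estimate to
  -- all pairs.
  set K : Set (ℝ × ℝ) := {q | |q.1| ^ p + |q.2| ^ p = 1 ∧ η ≤ |q.1 - q.2| ^ p} with hK
  have hle1 (q : ℝ × ℝ) (hq : q ∈ K) : |q.1| ≤ 1 ∧ |q.2| ≤ 1 := by
    have h1 := Real.rpow_nonneg (abs_nonneg q.1) p
    have h2 := Real.rpow_nonneg (abs_nonneg q.2) p
    have h3 := hq.1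
    constructor <;> refine not_lt.1 fun h => ?_ <;>
      linarith [Real.one_lt_rpow h hp0]
  have hKc : IsCompact K := by
    refine Metric.isCompact_of_isClosed_isBounded ?_ ?_
    · exact (isClosed_eq ((hc _ continuous_fst).add (hc _ continuous_snd)) continuous_const).inter
        (isClosed_le continuous_const (hc _ (continuous_fst.sub continuous_snd)))
    · refine (Metric.isBounded_closedBall (x := (0 : ℝ × ℝ)) (r := 1)).subset fun q hq => ?_
      rw [mem_closedBall_zero_iff, Prod.norm_def, max_le_iff]
      exact hle1 q hq
  have hdc : Continuous fun q : ℝ × ℝ => rpowDefect p q.1 q.2 :=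
    (((hc _ continuous_fst).add (hc _ continuous_snd)).div_const 2).sub
      (hc _ ((continuous_fst.add continuous_snd).div_const 2))
  obtain ⟨c, hc0, hcK⟩ : ∃ c, 0 < c ∧ ∀ q ∈ K, c ≤ rpowDefect p q.1 q.2 := by
    rcases K.eq_empty_or_nonempty with he | hne
    · exact ⟨1, one_pos, by simp [he]⟩
    · obtain ⟨q, hq, hmin⟩ := hKc.exists_isMinOn hne hdc.continuousOn
      refine ⟨_, rpowDefect_pos hp (a := q.1) (b := q.2) fun h => ?_, fun r hr => hmin hr⟩
      have := hq.2
      rw [h, sub_self, abs_zero, Real.zero_rpow hp0.ne'] at this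
      linarith
  -- On `K` both entries are at most 1 in modulus, so `|a - b|^p ≤ 2^p`, while the defect is at
  -- least `c`.
  refine ⟨2 ^ p / c, by positivity, fun a b => ?_⟩
  have hd := rpowDefect_nonneg hp a b
  by_cases hab : |a - b| ^ p ≤ η * (|a| ^ p + |b| ^ p)
  · have : 0 ≤ 2 ^ p / c * rpowDefect p a b := by positivity
    linarith
  push Not at hab
  set s := |a| ^ p + |b| ^ p with hs
  have ha0 := Real.rpow_nonneg (abs_nonneg a) p
  have hb0 := Real.rpow_nonneg (abs_nonneg b) p
  have hs0 : 0 < s := by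
    rcases (add_nonneg ha0 hb0).lt_or_eq with h | h
    · exact h
    · exfalso
      have ha : |a| ^ p = 0 := by linarith
      have hb : |b| ^ p = 0 := by linarith
      rw [Real.rpow_eq_zero (abs_nonneg _) hp0.ne', abs_eq_zero] at ha hb
      simp [hs, ha, hb, Real.zero_rpow hp0.ne'] at hab
  set t := s ^ (-(1 / p)) with ht
  have ht0 : 0 < t := Real.rpow_pos_of_pos hs0 _
  have htp : t ^ p = s⁻¹ := by
    rw [ht, ← Real.rpow_mul hs0.le, neg_mul, one_div_mul_cancel hp0.ne', Real.rpow_neg_one]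
  have habs (x : ℝ) : |t * x| ^ p = s⁻¹ * |x| ^ p := by
    rw [abs_mul, abs_of_pos ht0, Real.mul_rpow ht0.le (abs_nonneg _), htp]
  have hq : (t * a, t * b) ∈ K := by
    refine ⟨?_, ?_⟩
    · simp only [habs]
      rw [← mul_add, inv_mul_cancel₀ hs0.ne']
    · simp only [← mul_sub, habs]
      rw [inv_mul_eq_div, le_div_iff₀ hs0]
      exact hab.le
  have h1 := hcK _ hq
  rw [rpowDefect_mul ht0.le, htp, inv_mul_eq_div, le_div_iff₀ hs0] at h1
  have h2 := hle1 _ hq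
  have h3 : |t * (a - b)| ^ p ≤ 2 ^ p := by
    refine Real.rpow_le_rpow (abs_nonneg _) ?_ hp0.le
    rw [mul_sub]
    linarith [abs_sub (t * a) (t * b), h2.1, h2.2]
  rw [habs, inv_mul_eq_div, div_le_iff₀ hs0] at h3
  have h4 : 2 ^ p * s ≤ 2 ^ p / c * rpowDefect p a b := by
    rw [div_mul_eq_mul_div, le_div_iff₀ hc0]
    have := mul_le_mul_of_nonneg_left h1 (by positivity : (0 : ℝ) ≤ 2 ^ p)
    linarith
  have : 0 ≤ η * s := by positivity
  linarith

variable {α : Type*} [MeasurableSpace α] {μ : Measure α} {p : ℝ}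

theorem MemLp.integral_abs_rpow {f : α → ℝ} (hp : 0 < p) (hf : MemLp f (ENNReal.ofReal p) μ) :
    ∫ x, |f x| ^ p ∂μ = (eLpNorm f (ENNReal.ofReal p) μ).toReal ^ p := by
  have hi : 0 ≤ ∫ x, |f x| ^ p ∂μ := integral_nonneg fun x => by positivity
  rw [hf.eLpNorm_eq_integral_rpow_norm (by simpa using hp) ENNReal.ofReal_ne_top,
    ENNReal.toReal_ofReal hp.le, ENNReal.toReal_ofReal (Real.rpow_nonneg (by simpa using hi) _),
    ← Real.rpow_mul (by simpa using hi), inv_mul_cancel₀ hp.ne', Real.rpow_one]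
  simp

theorem MemLp.integrable_abs_rpow {f : α → ℝ} (hp : 0 < p)
    (hf : MemLp f (ENNReal.ofReal p) μ) : Integrable (fun x => |f x| ^ p) μ := by
  have := hf.integrable_norm_rpow (by simpa using hp) ENNReal.ofReal_ne_top
  simpa [ENNReal.toReal_ofReal hp.le] using this

/-- Functions that nearly minimise a uniformly convex functional are close to each other. -/
theorem exists_eLpNorm_sub_lt (hp : 1 < p) {J : (α → ℝ) → ℝ} {c C m : ℝ} (hc : 0 < c)
    (hmid : ∀ a b, Measurable a → MemLp a (ENNReal.ofReal p) μ → Measurable b →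
      MemLp b (ENNReal.ofReal p) μ → J (fun x => (a x + b x) / 2) ≤ (J a + J b) / 2)
    (hlow : ∀ f, Measurable f → MemLp f (ENNReal.ofReal p) μ →
      -C - c / 2 * ∫ x, |f x| ^ p ∂μ ≤ J f)
    (hm : ∀ f, Measurable f → MemLp f (ENNReal.ofReal p) μ →
      m ≤ J f + c * ∫ x, |f x| ^ p ∂μ) {ε : ℝ} (hε : 0 < ε) :
    ∃ τ, 0 < τ ∧ ∀ a b, Measurable a → MemLp a (ENNReal.ofReal p) μ → Measurable b →
      MemLp b (ENNReal.ofReal p) μ → J a + c * ∫ x, |a x| ^ p ∂μ ≤ m + τ →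
      J b + c * ∫ x, |b x| ^ p ∂μ ≤ m + τ →
      eLpNorm (a - b) (ENNReal.ofReal p) μ < ENNReal.ofReal ε := by
  have hp0 : 0 < p := by linarith
  -- Bounds `∫ |f|^p` for near-minimisers: half of the penalty survives the lower bound on `J`, and
  -- `τ ≤ 1`. The choice of `η` below makes `η * 2R = ε^p / 2`.
  set R : ℝ := |2 * (m + 1 + C) / c| + 1 with hR
  have hR0 : 0 < R := by positivity
  set η := ε ^ p / (4 * R) with hη
  have hεp : 0 < ε ^ p := Real.rpow_pos_of_pos hε p
  have hη0 : 0 < η := by positivity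
  obtain ⟨D, hD, hdef⟩ := exists_abs_sub_rpow_le hp hη0
  refine ⟨min 1 (c * ε ^ p / (4 * (D + 1))), lt_min one_pos (by positivity), ?_⟩
  intro a b ham ha hbm hb hΨa hΨb
  have hi {f : α → ℝ} (hf : MemLp f (ENNReal.ofReal p) μ) := MemLp.integrable_abs_rpow hp0 hf
  have hbd {f : α → ℝ} (hfm : Measurable f) (hf : MemLp f (ENNReal.ofReal p) μ)
      (h : J f + c * ∫ x, |f x| ^ p ∂μ ≤ m + min 1 (c * ε ^ p / (4 * (D + 1)))) :
      ∫ x, |f x| ^ p ∂μ ≤ R := by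
    have h1 := hlow f hfm hf
    have h2 := min_le_left 1 (c * ε ^ p / (4 * (D + 1)))
    have h3 : ∫ x, |f x| ^ p ∂μ ≤ 2 * (m + 1 + C) / c := by
      rw [le_div_iff₀ hc]
      linarith
    linarith [le_abs_self (2 * (m + 1 + C) / c)]
  have hmm : Measurable fun x => (a x + b x) / 2 := by fun_prop
  have hmid_mem : MemLp (fun x => (a x + b x) / 2) (ENNReal.ofReal p) μ := by
    have := (ha.add hb).const_mul (1 / 2)
    refine this.congr_norm hmm.aestronglyMeasurable (Eventually.of_forall fun x => ?_)
    simp only [Pi.add_apply]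
    ring_nf
  have hab : Integrable (fun x => |a x| ^ p + |b x| ^ p) μ := (hi ha).add (hi hb)
  have hdi : Integrable (fun x => rpowDefect p (a x) (b x)) μ :=
    (hab.div_const 2).sub (hi hmid_mem)
  -- The midpoint has value at least `m`, the endpoints at most `m + τ`, and `J` is midpoint convex,
  -- so `c` times the integrated defect is at most `τ`.
  have hdint : c * ∫ x, rpowDefect p (a x) (b x) ∂μ ≤ c * ε ^ p / (4 * (D + 1)) := by
    have h1 : ∫ x, rpowDefect p (a x) (b x) ∂μ =
        ((∫ x, |a x| ^ p ∂μ) + ∫ x, |b x| ^ p ∂μ) / 2 - ∫ x, |(a x + b x) / 2| ^ p ∂μ := by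
      unfold rpowDefect
      rw [integral_sub (hab.div_const 2) (hi hmid_mem), integral_div,
        integral_add (hi ha) (hi hb)]
    have h2 := hmid a b ham ha hbm hb
    have h3 := hm _ hmm hmid_mem
    have h4 := min_le_right 1 (c * ε ^ p / (4 * (D + 1)))
    rw [h1]
    linarith
  have hsub : ∫ x, |(a - b) x| ^ p ∂μ ≤
      η * ((∫ x, |a x| ^ p ∂μ) + ∫ x, |b x| ^ p ∂μ) +
        D * ∫ x, rpowDefect p (a x) (b x) ∂μ := by
    rw [← integral_add (hi ha) (hi hb), ← integral_const_mul, ← integral_const_mul,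
      ← integral_add (hab.const_mul _) (hdi.const_mul _)]
    exact integral_mono (hi (ha.sub hb))
      ((hab.const_mul _).add (hdi.const_mul _)) fun x => hdef _ _
  have h5 : η * ((∫ x, |a x| ^ p ∂μ) + ∫ x, |b x| ^ p ∂μ) ≤ ε ^ p / 2 := by
    have h6 := mul_le_mul_of_nonneg_left (add_le_add (hbd ham ha hΨa) (hbd hbm hb hΨb)) hη0.le
    refine h6.trans (le_of_eq ?_)
    rw [hη]
    field_simp
    ring
  have h6 : D * ∫ x, rpowDefect p (a x) (b x) ∂μ ≤ ε ^ p / 4 := by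
    have h7 : ∫ x, rpowDefect p (a x) (b x) ∂μ ≤ ε ^ p / (4 * (D + 1)) := by
      rw [mul_div_assoc] at hdint
      exact le_of_mul_le_mul_left hdint hc
    refine (mul_le_mul_of_nonneg_left h7 hD).trans ?_
    rw [mul_div_assoc', div_le_div_iff₀ (by positivity) (by positivity)]
    nlinarith
  have h8 : (eLpNorm (a - b) (ENNReal.ofReal p) μ).toReal ^ p < ε ^ p := by
    rw [← MemLp.integral_abs_rpow hp0 (ha.sub hb)]
    linarith
  rw [Real.rpow_lt_rpow_iff ENNReal.toReal_nonneg hε.le hp0] at h8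
  exact (ENNReal.lt_ofReal_iff_toReal_lt (ha.sub hb).2.ne).2 h8

/-- Existence of minimisers for a lower semicontinuous and convex perturbation of
`f ↦ c * ∫ |f| ^ p`. -/
theorem exists_minimizer_add_integral_abs_rpow (hp : 1 < p) {J : (α → ℝ) → ℝ} {c C : ℝ}
    (hc : 0 < c)
    (hmid : ∀ a b, Measurable a → MemLp a (ENNReal.ofReal p) μ → Measurable b →
      MemLp b (ENNReal.ofReal p) μ → J (fun x => (a x + b x) / 2) ≤ (J a + J b) / 2)
    (hlow : ∀ f, Measurable f → MemLp f (ENNReal.ofReal p) μ →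
      -C - c / 2 * ∫ x, |f x| ^ p ∂μ ≤ J f)
    (hlsc : ∀ (f : ℕ → α → ℝ) (F : α → ℝ), (∀ n, Measurable (f n)) →
      (∀ n, MemLp (f n) (ENNReal.ofReal p) μ) → Measurable F → MemLp F (ENNReal.ofReal p) μ →
      Tendsto (fun n => eLpNorm (f n - F) (ENNReal.ofReal p) μ) atTop (𝓝 0) →
      ∃ e : ℕ → ℝ, Tendsto e atTop (𝓝 0) ∧ ∀ n, J F ≤ J (f n) + e n) :
    ∃ F, Measurable F ∧ MemLp F (ENNReal.ofReal p) μ ∧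
      ∀ f, Measurable f → MemLp f (ENNReal.ofReal p) μ →
        J F + c * ∫ x, |F x| ^ p ∂μ ≤ J f + c * ∫ x, |f x| ^ p ∂μ := by
  have hp0 : 0 < p := by linarith
  set V : Set ℝ := {v | ∃ f, Measurable f ∧ MemLp f (ENNReal.ofReal p) μ ∧
    v = J f + c * ∫ x, |f x| ^ p ∂μ}
  have hVne : V.Nonempty := ⟨_, 0, measurable_zero, MemLp.zero, rfl⟩
  have hVbdd : BddBelow V := by
    refine ⟨-C, ?_⟩
    rintro _ ⟨f, hfm, hf, rfl⟩
    have h1 := hlow f hfm hf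
    have h2 : 0 ≤ ∫ x, |f x| ^ p ∂μ := integral_nonneg fun x => by positivity
    have h3 : 0 ≤ c / 2 * ∫ x, |f x| ^ p ∂μ := by positivity
    linarith
  set m := sInf V
  have hm (f : α → ℝ) (hfm : Measurable f) (hf : MemLp f (ENNReal.ofReal p) μ) :
      m ≤ J f + c * ∫ x, |f x| ^ p ∂μ := csInf_le hVbdd ⟨f, hfm, hf, rfl⟩
  have hex (n : ℕ) : ∃ f, Measurable f ∧ MemLp f (ENNReal.ofReal p) μ ∧
      J f + c * ∫ x, |f x| ^ p ∂μ < m + 1 / ((n : ℝ) + 1) := by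
    obtain ⟨_, ⟨f, hfm, hf, rfl⟩, hlt⟩ := Real.lt_sInf_add_pos hVne
      (by positivity : (0 : ℝ) < 1 / ((n : ℝ) + 1))
    exact ⟨f, hfm, hf, hlt⟩
  choose f hfm hf hlt using hex
  have : Fact (1 ≤ ENNReal.ofReal p) := ⟨by simpa using hp.le⟩
  -- Any two late terms nearly minimise, hence are close in `L^p`.
  have hcau : CauchySeq fun n => (hf n).toLp (f n) := by
    rw [Metric.cauchySeq_iff]
    intro ε hε
    obtain ⟨τ, hτ, hclose⟩ := exists_eLpNorm_sub_lt hp hc hmid hlow hm hε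
    obtain ⟨n₀, hn₀⟩ := exists_nat_one_div_lt hτ
    have hle (n : ℕ) (hn : n₀ ≤ n) : J (f n) + c * ∫ x, |f n x| ^ p ∂μ ≤ m + τ := by
      have : 1 / ((n : ℝ) + 1) ≤ 1 / ((n₀ : ℝ) + 1) := Nat.one_div_le_one_div hn
      linarith [hlt n]
    refine ⟨n₀, fun i hi j hj => ?_⟩
    have := hclose _ _ (hfm i) (hf i) (hfm j) (hf j) (hle i hi) (hle j hj)
    rw [← Lp.edist_toLp_toLp _ _ (hf i) (hf j), edist_dist] at this
    exact (ENNReal.ofReal_lt_ofReal_iff hε).1 this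
  obtain ⟨F', hF'⟩ := cauchySeq_tendsto_of_complete hcau
  obtain ⟨F, hFm, hFp, rfl⟩ : ∃ (F : α → ℝ) (_ : Measurable F)
      (hFp : MemLp F (ENNReal.ofReal p) μ), hFp.toLp F = F' :=
    ⟨F', (Lp.stronglyMeasurable F').measurable, Lp.memLp F', Lp.toLp_coeFn _ _⟩
  have hconv : Tendsto (fun n => eLpNorm (f n - F) (ENNReal.ofReal p) μ) atTop (𝓝 0) := by
    have h := tendsto_iff_edist_tendsto_0.1 hF'
    refine h.congr fun n => ?_
    rw [← Lp.edist_toLp_toLp _ _ (hf n) hFp]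
  have hnorm : Tendsto (fun n => ∫ x, |f n x| ^ p ∂μ) atTop (𝓝 (∫ x, |F x| ^ p ∂μ)) := by
    have h := (hF'.norm).rpow_const (p := p) (Or.inr hp0.le)
    rw [MemLp.integral_abs_rpow hp0 hFp, ← Lp.norm_toLp F hFp]
    refine h.congr fun n => ?_
    rw [MemLp.integral_abs_rpow hp0 (hf n), Lp.norm_toLp]
  obtain ⟨e, he, hJ⟩ := hlsc f F hfm hf hFm hFp hconv
  refine ⟨F, hFm, hFp, fun f' hf'm hf' => le_trans ?_ (hm f' hf'm hf')⟩
  have hlim : Tendsto (fun n : ℕ => m + 1 / ((n : ℝ) + 1) + e n +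
      c * ((∫ x, |F x| ^ p ∂μ) - ∫ x, |f n x| ^ p ∂μ)) atTop
      (𝓝 (m + 0 + 0 + c * ((∫ x, |F x| ^ p ∂μ) - ∫ x, |F x| ^ p ∂μ))) :=
    ((tendsto_const_nhds.add tendsto_one_div_add_atTop_nhds_zero_nat).add he).add
      ((tendsto_const_nhds.sub hnorm).const_mul c)
  simp only [sub_self, mul_zero, add_zero] at hlim
  refine ge_of_tendsto' hlim fun n => ?_
  have h1 := hJ n
  have h2 := hlt n
  linarith

end Minimizer

/-! ### The penalised dual problem and its Euler-Lagrange equation. -/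

section EulerLagrange

open Filter Topology

variable {d : ℕ}

local notation "𝔼" => EuclideanSpace ℝ (Fin d)

theorem one_lt_pExp {k : ℕ} (hk : 2 ≤ k) : 1 < pExp k := by
  have h : k + 1 < 2 ^ k := by
    induction k, hk using Nat.le_induction with
    | base => norm_num
    | succ n _ ih => rw [pow_succ]; omega
  unfold pExp
  rw [one_lt_div (by positivity)]
  exact_mod_cast h

theorem holderConjugate_pExp_sExp {k : ℕ} (hk : 2 ≤ k) :
    (pExp k).HolderConjugate (sExp k) := by
  rw [Real.holderConjugate_iff]
  refine ⟨one_lt_pExp hk, ?_⟩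
  unfold pExp sExp
  rw [inv_div, inv_div]
  field_simp
  ring

theorem eLpNorm_ofReal_pExp (k : ℕ) (f : 𝔼 → ℝ) :
    eLpNorm f (ENNReal.ofReal (pExp k)) volume = eLpNorm' f (pExp k) volume := by
  rw [eLpNorm_eq_eLpNorm' (by simpa using pExp_pos k) ENNReal.ofReal_ne_top,
    ENNReal.toReal_ofReal (pExp_pos k).le]

theorem isTest_iff {k : ℕ} {f : 𝔼 → ℝ} :
    IsTest k f ↔ Measurable f ∧ MemLp f (ENNReal.ofReal (pExp k)) volume := by
  refine ⟨fun h => ⟨h.1, h.1.aestronglyMeasurable, ?_⟩, fun h => ⟨h.1, ?_⟩⟩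
  · rw [eLpNorm_ofReal_pExp]
    exact h.2
  · rw [← eLpNorm_ofReal_pExp]
    exact h.2.2

theorem IsTest.memLp {k : ℕ} {f : 𝔼 → ℝ} (hf : IsTest k f) :
    MemLp f (ENNReal.ofReal (pExp k)) volume := (isTest_iff.1 hf).2

theorem IsTest.add {k : ℕ} {f w : 𝔼 → ℝ} (hf : IsTest k f) (hw : IsTest k w) :
    IsTest k (fun x => f x + w x) :=
  isTest_iff.2 ⟨hf.1.add hw.1, hf.memLp.add hw.memLp⟩

theorem IsTest.sub {k : ℕ} {f w : 𝔼 → ℝ} (hf : IsTest k f) (hw : IsTest k w) :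
    IsTest k (fun x => f x - w x) :=
  isTest_iff.2 ⟨hf.1.sub hw.1, hf.memLp.sub hw.memLp⟩

theorem IsTest.const_mul {k : ℕ} {f : 𝔼 → ℝ} (hf : IsTest k f) (c : ℝ) :
    IsTest k (fun x => c * f x) :=
  isTest_iff.2 ⟨hf.1.const_mul c, hf.memLp.const_mul c⟩

theorem IsTest.abs {k : ℕ} {f : 𝔼 → ℝ} (hf : IsTest k f) : IsTest k (fun x => |f x|) :=
  isTest_iff.2 ⟨hf.1.abs, hf.memLp.abs⟩

theorem isTest_indicator (k : ℕ) {A : Set 𝔼} (hA : MeasurableSet A) (hA' : volume A < ∞) :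
    IsTest k (A.indicator fun _ => (1 : ℝ)) :=
  isTest_iff.2 ⟨measurable_const.indicator hA, memLp_indicator_const _ hA _ (Or.inr hA'.ne)⟩

theorem cubeForm_const_mul_left (k : ℕ) (c : ℝ) (w f : 𝔼 → ℝ) :
    cubeForm k (fun x => c * w x) f = c * cubeForm k w f := by
  simp only [cubeForm, cubeIntegrand, mul_assoc]
  exact integral_const_mul _ _

theorem cubeForm_add_left {k : ℕ} {v w f : 𝔼 → ℝ} (hv : IsTest k v) (hw : IsTest k w)
    (hf : IsTest k f) :
    cubeForm k (fun x => v x + w x) f = cubeForm k v f + cubeForm k w f := by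
  simp only [cubeForm]
  rw [← integral_add (hv.integrable_cubeIntegrand hf) (hw.integrable_cubeIntegrand hf)]
  simp only [cubeIntegrand, add_mul]

theorem cubeForm_sub_left {k : ℕ} {v w f : 𝔼 → ℝ} (hv : IsTest k v) (hw : IsTest k w)
    (hf : IsTest k f) :
    cubeForm k (fun x => v x - w x) f = cubeForm k v f - cubeForm k w f := by
  simp only [cubeForm]
  rw [← integral_sub (hv.integrable_cubeIntegrand hf) (hw.integrable_cubeIntegrand hf)]
  simp only [cubeIntegrand, sub_mul]

theorem cubeForm_const_mul_self (k : ℕ) (c : ℝ) (f : 𝔼 → ℝ) :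
    cubeForm k (fun x => c * f x) (fun x => c * f x) = c ^ (2 ^ k) * cubeForm k f f := by
  simp only [cubeForm, cubeIntegrand_self, cubeFull, Finset.prod_mul_distrib, Finset.prod_const]
  simp only [Finset.card_univ, Fintype.card_pi, Fintype.card_fin, Finset.prod_const]
  exact integral_const_mul _ _

theorem enorm_cubeForm_le (k : ℕ) {w f : 𝔼 → ℝ} (hw : Measurable w) (hf : Measurable f) :
    ‖cubeForm k w f‖ₑ ≤ eLpNorm w (ENNReal.ofReal (pExp k)) volume *
      eLpNorm' f (pExp k) volume ^ (2 ^ k - 1) := by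
  rw [eLpNorm_ofReal_pExp]
  exact (enorm_integral_le_lintegral_enorm _).trans (lintegral_cubeIntegrand_le k hw hf)

/-- Add the tangent inequalities at the midpoint towards `a` and towards `b`; the linear terms
combine to twice the value at the midpoint. -/
theorem IsTest.cubeForm_midpoint_le {k : ℕ} {a b : 𝔼 → ℝ} (ha : IsTest k a) (hb : IsTest k b) :
    2 * cubeForm k (fun x => (a x + b x) / 2) (fun x => (a x + b x) / 2) ≤
      cubeForm k a a + cubeForm k b b := by
  have hm : IsTest k (fun x => (a x + b x) / 2) := by
    simpa only [div_eq_inv_mul] using (ha.add hb).const_mul 2⁻¹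
  have h1 := ha.cubeForm_le hm
  have h2 := hb.cubeForm_le hm
  have h3 := cubeForm_add_left ha hb hm
  have h4 := cubeForm_const_mul_left k 2 (fun x => (a x + b x) / 2) (fun x => (a x + b x) / 2)
  simp only [mul_div_cancel₀ _ (two_ne_zero' ℝ)] at h4
  rw [h3] at h4
  have h5 : 2 ^ k * cubeForm k a (fun x => (a x + b x) / 2) +
      2 ^ k * cubeForm k b (fun x => (a x + b x) / 2) =
      2 ^ k * (2 * cubeForm k (fun x => (a x + b x) / 2) (fun x => (a x + b x) / 2)) := by
    rw [← mul_add, h4]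
  linarith

/-- The derivative of `|x| ^ p / p`. -/
noncomputable def absPowDeriv (p x : ℝ) : ℝ := |x| ^ (p - 2) * x

theorem absPowDeriv_mul_self {p : ℝ} (hp : 1 < p) (x : ℝ) : absPowDeriv p x * x = |x| ^ p := by
  unfold absPowDeriv
  rcases eq_or_ne x 0 with rfl | hx
  · simp [Real.zero_rpow (by linarith : p ≠ 0)]
  · rw [mul_assoc, ← abs_mul_abs_self x, ← pow_two, ← Real.rpow_natCast,
      ← Real.rpow_add (abs_pos.2 hx)]
    congr 1
    push_cast
    ring

theorem abs_absPowDeriv {p : ℝ} (hp : 1 < p) (x : ℝ) : |absPowDeriv p x| = |x| ^ (p - 1) := by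
  unfold absPowDeriv
  rcases eq_or_ne x 0 with rfl | hx
  · simp [Real.zero_rpow (by linarith : p - 1 ≠ 0)]
  · rw [abs_mul, abs_of_nonneg (Real.rpow_nonneg (abs_nonneg x) _)]
    nth_rw 2 [← Real.rpow_one |x|]
    rw [← Real.rpow_add (abs_pos.2 hx)]
    congr 1
    ring

theorem continuous_absPowDeriv {p : ℝ} (hp : 1 < p) : Continuous (absPowDeriv p) := by
  have h := (contDiff_norm_rpow (E := ℝ) hp).continuous_deriv le_rfl
  have h2 : deriv (fun x : ℝ => ‖x‖ ^ p) = fun x => p * absPowDeriv p x := by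
    funext x
    rw [absPowDeriv, ← mul_assoc]
    exact (hasDerivAt_abs_rpow x hp).deriv
  rw [h2] at h
  have h3 := h.const_mul p⁻¹
  simpa [← mul_assoc, inv_mul_cancel₀ (by linarith : p ≠ 0)] using h3

/-- The subgradient inequality for `|x| ^ p`. -/
theorem absPowDeriv_mul_le {p : ℝ} (hp : 1 < p) (x y : ℝ) :
    p * (absPowDeriv p x * y) ≤ |y| ^ p + (p - 1) * |x| ^ p := by
  have hc := Real.HolderConjugate.conjExponent hp
  have h := Real.young_inequality_of_nonneg (abs_nonneg y)
    (Real.rpow_nonneg (abs_nonneg x) (p - 1)) hc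
  rw [← Real.rpow_mul (abs_nonneg x), hc.sub_one_mul_conj] at h
  have h1 : absPowDeriv p x * y ≤ |y| * |x| ^ (p - 1) := by
    rw [← abs_absPowDeriv hp, mul_comm |y|, ← abs_mul]
    exact le_abs_self _
  have hp0 : 0 < p := by linarith
  have h2 := mul_le_mul_of_nonneg_left (h1.trans h) hp0.le
  refine h2.trans (le_of_eq ?_)
  rw [Real.conjExponent]
  have : p - 1 ≠ 0 := by linarith
  field_simp

theorem enorm_integral_mul_le_eLpNorm {α : Type*} [MeasurableSpace α] {μ : Measure α} {p s : ℝ}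
    (hps : p.HolderConjugate s) {g f : α → ℝ} (hg : AEStronglyMeasurable g μ)
    (hf : AEStronglyMeasurable f μ) :
    ‖∫ x, g x * f x ∂μ‖ₑ ≤
      eLpNorm f (ENNReal.ofReal p) μ * eLpNorm g (ENNReal.ofReal s) μ := by
  have h0 {q : ℝ} (hq : 0 < q) (f : α → ℝ) :
      eLpNorm f (ENNReal.ofReal q) μ = (∫⁻ x, ‖f x‖ₑ ^ q ∂μ) ^ (1 / q) := by
    rw [eLpNorm_eq_eLpNorm' (by simpa using hq) ENNReal.ofReal_ne_top,
      ENNReal.toReal_ofReal hq.le, eLpNorm']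
  rw [h0 hps.pos, h0 hps.symm.pos]
  refine (enorm_integral_le_lintegral_enorm _).trans (le_trans (le_of_eq ?_)
    (ENNReal.lintegral_mul_le_Lp_mul_Lq μ hps hf.enorm hg.enorm))
  refine lintegral_congr fun x => ?_
  rw [Pi.mul_apply, enorm_mul, mul_comm]

theorem MemLp.integrable_mul_of_holderConjugate {α : Type*} [MeasurableSpace α] {μ : Measure α}
    {p s : ℝ} (hps : p.HolderConjugate s) {g f : α → ℝ} (hg : MemLp g (ENNReal.ofReal s) μ)
    (hf : MemLp f (ENNReal.ofReal p) μ) : Integrable (fun x => g x * f x) μ := by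
  refine Integrable.mono' (((MemLp.integrable_abs_rpow hps.pos hf).div_const p).add
    ((MemLp.integrable_abs_rpow hps.symm.pos hg).div_const s)) (hg.1.mul hf.1)
    (Eventually.of_forall fun x => ?_)
  rw [norm_mul, mul_comm]
  exact Real.young_inequality_of_nonneg (abs_nonneg _) (abs_nonneg _) hps

theorem tendsto_zero_of_enorm_le_mul {a : ℕ → ℝ} {b : ℕ → ℝ≥0∞} {C : ℝ≥0∞} (hC : C ≠ ∞)
    (hb : Tendsto b atTop (𝓝 0)) (h : ∀ n, ‖a n‖ₑ ≤ b n * C) : Tendsto a atTop (𝓝 0) := by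
  rw [tendsto_zero_iff_enorm_tendsto_zero]
  have := ENNReal.Tendsto.mul_const hb (Or.inr hC)
  rw [zero_mul] at this
  exact tendsto_of_tendsto_of_tendsto_of_le_of_le tendsto_const_nhds this (fun _ => zero_le) h

/-- The penalised dual problem has a solution. -/
theorem exists_penalized_minimizer {k : ℕ} (hk : 2 ≤ k) {δ : ℝ} (hδ : 0 < δ) {g : 𝔼 → ℝ}
    (hg : MemLp g (ENNReal.ofReal (sExp k)) volume) :
    ∃ F, IsTest k F ∧ ∀ f, IsTest k f →
      cubeForm k F F / 2 ^ k - (∫ x, g x * F x) +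
          δ ^ pExp k / pExp k * ∫ x, |F x| ^ pExp k ≤
        cubeForm k f f / 2 ^ k - (∫ x, g x * f x) +
          δ ^ pExp k / pExp k * ∫ x, |f x| ^ pExp k := by
  have hp := one_lt_pExp hk
  have hp0 := pExp_pos k
  have hps := holderConjugate_pExp_sExp hk
  have hs0 := hps.symm.pos
  have hgi {f : 𝔼 → ℝ} (hf : IsTest k f) : Integrable fun x => g x * f x :=
    MemLp.integrable_mul_of_holderConjugate hps hg hf.memLp
  obtain ⟨j, rfl⟩ : ∃ j, k = j + 1 := ⟨k - 1, by omega⟩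
  set p := pExp (j + 1)
  set s := sExp (j + 1)
  -- Chosen with `t^p = δ^p / 2`, so that Young's inequality for `(t f)(t⁻¹ g)` costs exactly half
  -- of the penalty.
  set t : ℝ := δ * (1 / 2) ^ (1 / p) with ht
  have ht0 : 0 < t := by positivity
  have htp : t ^ p = δ ^ p / 2 := by
    rw [ht, Real.mul_rpow hδ.le (by positivity), ← Real.rpow_mul (by norm_num),
      one_div_mul_cancel hp0.ne', Real.rpow_one]
    ring
  simp only [isTest_iff, and_assoc, and_imp]
  refine exists_minimizer_add_integral_abs_rpow
    hp (J := fun f => cubeForm (j + 1) f f / 2 ^ (j + 1) - ∫ x, g x * f x)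
    (c := δ ^ p / p) (C := ∫ x, |t⁻¹ * g x| ^ s / s) (by positivity) ?_ ?_ ?_
  · intro a b ham ha hbm hb
    have ha' : IsTest (j + 1) a := isTest_iff.2 ⟨ham, ha⟩
    have hb' : IsTest (j + 1) b := isTest_iff.2 ⟨hbm, hb⟩
    have h1 := div_le_div_of_nonneg_right (ha'.cubeForm_midpoint_le hb')
      (by positivity : (0 : ℝ) ≤ 2 ^ (j + 1))
    have h2 : ∫ x, g x * ((a x + b x) / 2) = ((∫ x, g x * a x) + ∫ x, g x * b x) / 2 := by
      rw [← integral_add (hgi ha') (hgi hb'), ← integral_div]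
      refine integral_congr_ae (Eventually.of_forall fun x => ?_)
      dsimp only
      ring
    dsimp only
    rw [h2]
    rw [mul_div_assoc, add_div] at h1
    linarith
  · intro f hfm hf
    have hf' : IsTest (j + 1) f := isTest_iff.2 ⟨hfm, hf⟩
    have h1 : 0 ≤ cubeForm (j + 1) f f / 2 ^ (j + 1) :=
      div_nonneg hf'.cubeForm_self_nonneg (by positivity)
    have hgI := (MemLp.integrable_abs_rpow hs0 (hg.const_mul t⁻¹)).div_const s
    have hfI := MemLp.integrable_abs_rpow hp0 hf
    have h2 : ∫ x, g x * f x ≤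
        ∫ x, (|t⁻¹ * g x| ^ s / s + δ ^ p / p / 2 * |f x| ^ p) := by
      refine integral_mono (hgi hf') (hgI.add (hfI.const_mul _)) fun x => ?_
      have h3 := Real.young_inequality_of_nonneg (abs_nonneg (t * f x))
        (abs_nonneg (t⁻¹ * g x)) hps
      have h4 : g x * f x ≤ |t * f x| * |t⁻¹ * g x| := by
        rw [← abs_mul]
        refine le_trans (le_of_eq ?_) (le_abs_self _)
        field_simp
      refine (h4.trans h3).trans (le_of_eq ?_)
      rw [abs_mul t, abs_of_pos ht0, Real.mul_rpow ht0.le (abs_nonneg _), htp]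
      ring
    rw [integral_add hgI (hfI.const_mul _), integral_const_mul] at h2
    linarith
  · intro f F hfm hf hFm hFp hlim
    have hf' (n : ℕ) : IsTest (j + 1) (f n) := isTest_iff.2 ⟨hfm n, hf n⟩
    have hF' : IsTest (j + 1) F := isTest_iff.2 ⟨hFm, hFp⟩
    -- The error is minus the linear part of `J` at `F` in the direction `f n - F`. The tangent
    -- inequality for the cube form shows that it suffices, and it tends to 0 by Hölder and the cube
    -- bound.
    refine ⟨fun n => (∫ x, g x * (f n x - F x)) - cubeForm (j + 1) (fun x => f n x - F x) F,
      ?_, fun n => ?_⟩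
    · rw [← sub_zero (0 : ℝ)]
      refine Tendsto.sub ?_ ?_
      · exact tendsto_zero_of_enorm_le_mul hg.2.ne hlim fun n =>
          enorm_integral_mul_le_eLpNorm hps hg.1 ((hf n).sub hFp).1
      · exact tendsto_zero_of_enorm_le_mul (ENNReal.pow_lt_top hF'.2).ne hlim fun n =>
          enorm_cubeForm_le _ ((hfm n).sub hFm) hFm
    · have h1 := (hf' n).cubeForm_le hF'
      have h2 := cubeForm_sub_left (hf' n) hF' hF'
      have h3 : ∫ x, g x * (f n x - F x) = (∫ x, g x * f n x) - ∫ x, g x * F x := by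
        rw [← integral_sub (hgi (hf' n)) (hgi hF')]
        simp only [mul_sub]
      dsimp only
      rw [h2, h3]
      have hN : (0 : ℝ) < 2 ^ (j + 1) := by positivity
      have h4 : cubeForm (j + 1) (f n) F ≤ cubeForm (j + 1) (f n) (f n) / 2 ^ (j + 1) +
          cubeForm (j + 1) F F - cubeForm (j + 1) F F / 2 ^ (j + 1) := by
        have h5 := div_le_div_of_nonneg_right h1 hN.le
        rw [mul_div_cancel_left₀ _ hN.ne'] at h5
        refine h5.trans (le_of_eq ?_)
        field_simp
        ring
      linarith

theorem abs_cubeProd_le {k : ℕ} {f v : 𝔼 → ℝ} (hfv : ∀ x, |f x| ≤ v x) (x : 𝔼)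
    (h : Fin k → 𝔼) : |cubeProd k f x h| ≤ cubeProd k v x h := by
  unfold cubeProd
  rw [Finset.abs_prod]
  exact Finset.prod_le_prod (fun _ _ => abs_nonneg _) fun _ _ => hfv _

theorem IsTest.tendsto_cubeForm {k : ℕ} {w v f : 𝔼 → ℝ} {fs : ℕ → 𝔼 → ℝ} (hw : IsTest k w)
    (hv : IsTest k v) (hfs : ∀ n, Measurable (fs n)) (hle : ∀ n x, |fs n x| ≤ v x)
    (hlim : ∀ x, Tendsto (fun n => fs n x) atTop (𝓝 (f x))) :
    Tendsto (fun n => cubeForm k w (fs n)) atTop (𝓝 (cubeForm k w f)) := by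
  refine tendsto_integral_of_dominated_convergence (cubeIntegrand k (fun x => |w x|) v)
    (fun n => (measurable_cubeIntegrand hw.1 (hfs n)).aestronglyMeasurable)
    (hw.abs.integrable_cubeIntegrand hv) (fun n => Eventually.of_forall fun z => ?_)
    (Eventually.of_forall fun z => ?_)
  · rw [cubeIntegrand, norm_mul]
    exact mul_le_mul_of_nonneg_left (abs_cubeProd_le (hle n) _ _) (abs_nonneg _)
  · exact (tendsto_finsetProd _ fun α _ => hlim _).const_mul _

/-- The integrand is dominated by `(|F| + |w|)^p`. -/
theorem IsTest.integrable_absPowDeriv_mul {k : ℕ} (hk : 2 ≤ k) {F w : 𝔼 → ℝ} (hF : IsTest k F)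
    (hw : IsTest k w) : Integrable fun x => absPowDeriv (pExp k) (F x) * w x := by
  have hp := one_lt_pExp hk
  have hm := (continuous_absPowDeriv hp).measurable
  have hF1 := hF.1
  have hw1 := hw.1
  refine Integrable.mono' (MemLp.integrable_abs_rpow (pExp_pos k) (hF.abs.add hw.abs).memLp)
    (by fun_prop) (Eventually.of_forall fun x => ?_)
  have h0 : 0 ≤ |F x| + |w x| := by positivity
  rw [norm_mul, Real.norm_eq_abs, Real.norm_eq_abs, abs_absPowDeriv hp,
    ← absPowDeriv_mul_self hp]
  have h1 : absPowDeriv (pExp k) (|F x| + |w x|) = (|F x| + |w x|) ^ (pExp k - 1) := by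
    rw [← abs_of_nonneg (a := absPowDeriv _ _), abs_absPowDeriv hp, abs_of_nonneg h0]
    exact mul_nonneg (Real.rpow_nonneg (abs_nonneg _) _) h0
  rw [h1]
  exact mul_le_mul (Real.rpow_le_rpow (abs_nonneg _) (by linarith [abs_nonneg (w x)])
    (by linarith)) (by linarith [abs_nonneg (F x)]) (abs_nonneg _) (by positivity)

theorem IsTest.tendsto_integral_absPowDeriv {k : ℕ} (hk : 2 ≤ k) {w v f : 𝔼 → ℝ}
    {fs : ℕ → 𝔼 → ℝ} (hw : IsTest k w) (hv : IsTest k v) (hfs : ∀ n, Measurable (fs n))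
    (hle : ∀ n x, |fs n x| ≤ v x) (hlim : ∀ x, Tendsto (fun n => fs n x) atTop (𝓝 (f x))) :
    Tendsto (fun n => ∫ x, absPowDeriv (pExp k) (fs n x) * w x) atTop
      (𝓝 (∫ x, absPowDeriv (pExp k) (f x) * w x)) := by
  have hp := one_lt_pExp hk
  have hc := continuous_absPowDeriv hp
  have hm := hc.measurable
  have hw1 := hw.1
  refine tendsto_integral_of_dominated_convergence _ (fun n => ?_)
    (hv.integrable_absPowDeriv_mul hk hw).norm (fun n => Eventually.of_forall fun x => ?_)
    (Eventually.of_forall fun x => ?_)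
  · have := hfs n
    fun_prop
  · rw [norm_mul, norm_mul, Real.norm_eq_abs, Real.norm_eq_abs (absPowDeriv _ (v x)),
      abs_absPowDeriv hp, abs_absPowDeriv hp]
    exact mul_le_mul_of_nonneg_right (Real.rpow_le_rpow (abs_nonneg _)
      ((hle n x).trans (le_abs_self _)) (by linarith)) (norm_nonneg _)
  · exact ((hc.tendsto _).comp (hlim x)).mul_const _

/-- The Euler-Lagrange equation of the penalised dual problem, as an inequality. -/
theorem integral_mul_le_of_minimizer {k : ℕ} (hk : 2 ≤ k) {δ : ℝ} (hδ : 0 < δ) {g F w : 𝔼 → ℝ}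
    (hg : MemLp g (ENNReal.ofReal (sExp k)) volume) (hF : IsTest k F) (hw : IsTest k w)
    (hmin : ∀ f, IsTest k f →
      cubeForm k F F / 2 ^ k - (∫ x, g x * F x) +
          δ ^ pExp k / pExp k * ∫ x, |F x| ^ pExp k ≤
        cubeForm k f f / 2 ^ k - (∫ x, g x * f x) +
          δ ^ pExp k / pExp k * ∫ x, |f x| ^ pExp k) :
    ∫ x, g x * w x ≤
      cubeForm k w F + δ ^ pExp k * ∫ x, absPowDeriv (pExp k) (F x) * w x := by
  have hp := one_lt_pExp hk
  have hp0 := pExp_pos k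
  have hps := holderConjugate_pExp_sExp hk
  set p := pExp k
  have hgi {f : 𝔼 → ℝ} (hf : IsTest k f) : Integrable fun x => g x * f x :=
    MemLp.integrable_mul_of_holderConjugate hps hg hf.memLp
  -- Minimality is compared with the tangent inequalities at `G = F + t w`, not at `F`. This gives
  -- an exact inequality for every `t > 0`, and dominated convergence, with bound `|F| + |w|`,
  -- replaces `G` by `F` along `t = 1 / (n + 1)`.
  have hstep (t : ℝ) (ht : 0 < t) : ∫ x, g x * w x ≤
      cubeForm k w (fun x => F x + t * w x) +
        δ ^ p * ∫ x, absPowDeriv p (F x + t * w x) * w x := by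
    have hG : IsTest k (fun x => F x + t * w x) := hF.add (hw.const_mul t)
    have hm := hmin _ hG
    set G : 𝔼 → ℝ := fun x => F x + t * w x with hGdef
    have h1 : ∫ x, g x * G x = (∫ x, g x * F x) + t * ∫ x, g x * w x := by
      rw [← integral_const_mul, ← integral_add (hgi hF) ((hgi hw).const_mul t)]
      refine integral_congr_ae (Eventually.of_forall fun x => ?_)
      simp only [hGdef]
      ring
    have h2 : cubeForm k G G - t * cubeForm k w G = cubeForm k F G := by
      have h := cubeForm_add_left hF (hw.const_mul t) hG
      rw [cubeForm_const_mul_left] at h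
      change cubeForm k G G = _ at h
      linarith
    have hN : (0 : ℝ) < 2 ^ k := by positivity
    have h3 : (cubeForm k G G - cubeForm k F F) / 2 ^ k ≤ t * cubeForm k w G := by
      have h := hF.cubeForm_le hG
      rw [← h2] at h
      rw [div_le_iff₀ hN]
      linarith
    have hFi := MemLp.integrable_abs_rpow hp0 hF.memLp
    have hGi := MemLp.integrable_abs_rpow hp0 hG.memLp
    have hGF := hG.integrable_absPowDeriv_mul hk hF
    have hGw := hG.integrable_absPowDeriv_mul hk hw
    have h4 : p * ∫ x, absPowDeriv p (G x) * F x ≤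
        (∫ x, |F x| ^ p) + (p - 1) * ∫ x, |G x| ^ p := by
      rw [← integral_const_mul, ← integral_const_mul, ← integral_add hFi (hGi.const_mul _)]
      exact integral_mono (hGF.const_mul _) (hFi.add (hGi.const_mul _)) fun x =>
        absPowDeriv_mul_le hp _ _
    have h5 : ∫ x, |G x| ^ p =
        (∫ x, absPowDeriv p (G x) * F x) + t * ∫ x, absPowDeriv p (G x) * w x := by
      rw [← integral_const_mul, ← integral_add hGF (hGw.const_mul t)]
      refine integral_congr_ae (Eventually.of_forall fun x => ?_)
      dsimp only
      rw [← absPowDeriv_mul_self hp]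
      simp only [hGdef]
      ring
    have h6 : (∫ x, |G x| ^ p) - ∫ x, |F x| ^ p ≤
        p * (t * ∫ x, absPowDeriv p (G x) * w x) := by
      have : ∫ x, absPowDeriv p (G x) * F x =
        (∫ x, |G x| ^ p) - t * ∫ x, absPowDeriv p (G x) * w x := by linarith
      rw [this] at h4
      linarith
    have h7 : δ ^ p / p * ((∫ x, |G x| ^ p) - ∫ x, |F x| ^ p) ≤
        t * (δ ^ p * ∫ x, absPowDeriv p (G x) * w x) := by
      refine (mul_le_mul_of_nonneg_left h6 (by positivity)).trans (le_of_eq ?_)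
      field_simp
    rw [h1] at hm
    rw [sub_div] at h3
    refine le_of_mul_le_mul_left ?_ ht
    linarith
  have hw1 := hw.1
  have hF1 := hF.1
  have hv := hF.abs.add hw.abs
  have hmeas (n : ℕ) : Measurable fun x => F x + 1 / ((n : ℝ) + 1) * w x := by fun_prop
  have hle (n : ℕ) (x : 𝔼) : |F x + 1 / ((n : ℝ) + 1) * w x| ≤ |F x| + |w x| := by
    refine (abs_add_le _ _).trans (add_le_add le_rfl ?_)
    rw [abs_mul, abs_of_pos (by positivity)]
    refine mul_le_of_le_one_left (abs_nonneg _) ?_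
    rw [div_le_one (by positivity)]
    linarith [(Nat.cast_nonneg n : (0 : ℝ) ≤ n)]
  have hlim (x : 𝔼) : Tendsto (fun n : ℕ => F x + 1 / ((n : ℝ) + 1) * w x) atTop (𝓝 (F x)) := by
    have := (tendsto_one_div_add_atTop_nhds_zero_nat (𝕜 := ℝ)).mul_const (w x)
    simpa using this.const_add (F x)
  exact ge_of_tendsto' ((hw.tendsto_cubeForm hv hmeas hle hlim).add
    ((hw.tendsto_integral_absPowDeriv hk hv hmeas hle hlim).const_mul (δ ^ p)))
    fun n => hstep _ (by positivity)

/-- The penalised dual problem has a solution of its Euler-Lagrange equation. -/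
theorem exists_eulerLagrange {k : ℕ} (hk : 2 ≤ k) {δ : ℝ} (hδ : 0 < δ) {g : 𝔼 → ℝ}
    (hg : MemLp g (ENNReal.ofReal (sExp k)) volume) :
    ∃ F, IsTest k F ∧ ∀ w, IsTest k w → ∫ x, g x * w x =
      cubeForm k w F + δ ^ pExp k * ∫ x, absPowDeriv (pExp k) (F x) * w x := by
  obtain ⟨F, hF, hmin⟩ := exists_penalized_minimizer hk hδ hg
  refine ⟨F, hF, fun w hw =>
    le_antisymm (integral_mul_le_of_minimizer hk hδ hg hF hw hmin) ?_⟩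
  -- Both sides are linear in `w`, so the inequality for `-w` is the reverse one.
  have h := integral_mul_le_of_minimizer hk hδ hg hF (hw.const_mul (-1)) hmin
  rw [cubeForm_const_mul_left] at h
  simp only [neg_mul, one_mul, mul_neg, integral_neg] at h
  linarith

end EulerLagrange

/-! ### From the weak equation to the pointwise decomposition and its bounds. -/

section Decomposition

variable {d : ℕ}

local notation "𝔼" => EuclideanSpace ℝ (Fin d)

theorem IsTest.integral_mul_le_of_cubeForm_le {k : ℕ} (hk : 2 ≤ k) {g F : 𝔼 → ℝ} {c : ℝ}
    (hF : IsTest k F) (hg1 : antiUniformNorm k g ≤ 1) (hc : 0 < c)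
    (hFc : cubeForm k F F ≤ c ^ (2 ^ k)) : ∫ x, g x * F x ≤ c := by
  obtain ⟨j, rfl⟩ : ∃ j, k = j + 1 := ⟨k - 1, by omega⟩
  have hf := hF.const_mul c⁻¹
  have hn : gowersNorm (j + 1) (fun x => c⁻¹ * F x) ≤ 1 := by
    rw [← pow_le_one_iff (n := 2 ^ (j + 1)) (by positivity), hf.gowersNorm_pow,
      cubeForm_const_mul_self, ENNReal.ofReal_le_one, inv_pow, inv_mul_eq_div,
      div_le_one (by positivity)]
    exact hFc
  have h1 : ‖∫ x, g x * (c⁻¹ * F x)‖ₑ ≤ 1 :=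
    (le_iSup₂ (f := fun (f : 𝔼 → ℝ) (_ : MemLp f (ENNReal.ofReal (pExp (j + 1))) volume ∧
      gowersNorm (j + 1) f ≤ 1) => ‖∫ x, g x * f x‖ₑ) _ ⟨hf.memLp, hn⟩).trans hg1
  have h2 : ∫ x, g x * (c⁻¹ * F x) = c⁻¹ * ∫ x, g x * F x := by
    rw [← integral_const_mul]
    simp only [mul_left_comm]
  rw [h2, Real.enorm_eq_ofReal_abs, ENNReal.ofReal_le_one] at h1
  have h3 := (le_abs_self _).trans h1
  rwa [inv_mul_eq_div, div_le_one hc] at h3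

/-- Since `v` may vanish, `F` is normalised by `v + ε` instead, and `ε` is arbitrary. -/
theorem IsTest.integral_mul_le_of_cubeForm_eq {k : ℕ} (hk : 2 ≤ k) {g F : 𝔼 → ℝ} (hF : IsTest k F)
    (hg1 : antiUniformNorm k g ≤ 1) {v : ℝ} (hv : 0 ≤ v) (hFv : cubeForm k F F = v ^ (2 ^ k)) :
    ∫ x, g x * F x ≤ v := by
  refine le_of_forall_pos_le_add fun ε hε => ?_
  refine hF.integral_mul_le_of_cubeForm_le hk hg1 (by positivity) ?_
  rw [hFv]
  exact pow_le_pow_left₀ hv (by linarith) _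

/-- The constant 1 need not lie in `L^{p_k}`, so Fubini is applied with indicators of finite-measure
sets exhausting the space. -/
theorem IsTest.ae_integrable_cubeProd {k : ℕ} {F : 𝔼 → ℝ} (hF : IsTest k F) :
    ∀ᵐ x : 𝔼, Integrable (cubeProd k F x) volume := by
  have h (n : ℕ) := ((isTest_indicator k (measurableSet_spanningSets (volume : Measure 𝔼) n)
    (measure_spanningSets_lt_top volume n)).integrable_cubeIntegrand hF).prod_left_ae
  filter_upwards [ae_all_iff.2 h] with x hx
  obtain ⟨n, hn⟩ := Set.mem_iUnion.1
    ((iUnion_spanningSets (volume : Measure 𝔼)).symm ▸ Set.mem_univ x)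
  simpa [cubeIntegrand, Set.indicator_of_mem hn] using hx n

theorem IsTest.integrable_mul_dualFun {k : ℕ} {w F : 𝔼 → ℝ} (hw : IsTest k w)
    (hF : IsTest k F) : Integrable fun x => w x * dualFun k F x := by
  have h := (hw.integrable_cubeIntegrand hF).integral_prod_right
  simpa only [cubeIntegrand, integral_const_mul, dualFun] using h

theorem IsTest.cubeForm_eq_integral_dualFun {k : ℕ} {w F : 𝔼 → ℝ} (hw : IsTest k w)
    (hF : IsTest k F) : cubeForm k w F = ∫ x, w x * dualFun k F x := by
  rw [cubeForm, Measure.volume_eq_prod, integral_prod_symm _ (hw.integrable_cubeIntegrand hF)]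
  simp only [cubeIntegrand, integral_const_mul]
  rfl

/-- Indicators of finite-measure sets are admissible `w`, and their integrals determine a locally
integrable function almost everywhere. -/
theorem ae_eq_dualFun_add {k : ℕ} (hk : 2 ≤ k) {g F : 𝔼 → ℝ} {c : ℝ}
    (hg : MemLp g (ENNReal.ofReal (sExp k)) volume) (hF : IsTest k F)
    (h : ∀ w, IsTest k w → ∫ x, g x * w x =
      cubeForm k w F + c * ∫ x, absPowDeriv (pExp k) (F x) * w x) :
    ∀ᵐ x : 𝔼, g x = dualFun k F x + c * absPowDeriv (pExp k) (F x) := by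
  have hps := holderConjugate_pExp_sExp hk
  have hind (u : 𝔼 → ℝ) (A : Set 𝔼) :
      A.indicator u = fun x => u x * A.indicator (fun _ => (1 : ℝ)) x := by
    funext x
    by_cases hx : x ∈ A <;> simp [hx]
  have hind' (u : 𝔼 → ℝ) (A : Set 𝔼) :
      A.indicator u = fun x => A.indicator (fun _ => (1 : ℝ)) x * u x := by
    simp only [hind u, mul_comm]
  have hgi (A : Set 𝔼) (hA : MeasurableSet A) (hA' : volume A < ∞) : IntegrableOn g A := by
    rw [← integrable_indicator_iff hA, hind]
    exact MemLp.integrable_mul_of_holderConjugate hps hg (isTest_indicator k hA hA').memLp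
  have hDi (A : Set 𝔼) (hA : MeasurableSet A) (hA' : volume A < ∞) :
      IntegrableOn (dualFun k F) A := by
    rw [← integrable_indicator_iff hA, hind']
    exact (isTest_indicator k hA hA').integrable_mul_dualFun hF
  have hHi (A : Set 𝔼) (hA : MeasurableSet A) (hA' : volume A < ∞) :
      IntegrableOn (fun x => c * absPowDeriv (pExp k) (F x)) A := by
    refine Integrable.const_mul ?_ c
    change IntegrableOn _ A
    rw [← integrable_indicator_iff hA, hind]
    exact hF.integrable_absPowDeriv_mul hk (isTest_indicator k hA hA')
  refine ae_eq_of_forall_setIntegral_eq_of_sigmaFinite hgi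
    (fun A hA hA' => (hDi A hA hA').add (hHi A hA hA')) fun A hA hA' => ?_
  have hT := isTest_indicator k hA hA'
  rw [integral_add (hDi A hA hA') (hHi A hA hA'), integral_const_mul, ← integral_indicator hA,
    ← integral_indicator hA, ← integral_indicator hA, hind g, hind' (dualFun k F),
    hind (fun x => absPowDeriv _ _), h _ hT, hT.cubeForm_eq_integral_dualFun hF]

theorem eLpNorm_le_of_integral_abs_rpow_le {α : Type*} [MeasurableSpace α] {μ : Measure α}
    {q b : ℝ} (hq : 0 < q) (hb : 0 ≤ b) {f : α → ℝ} (hf : MemLp f (ENNReal.ofReal q) μ)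
    (h : ∫ x, |f x| ^ q ∂μ ≤ b ^ q) : eLpNorm f (ENNReal.ofReal q) μ ≤ ENNReal.ofReal b := by
  rw [MemLp.integral_abs_rpow hq hf, Real.rpow_le_rpow_iff ENNReal.toReal_nonneg hb hq] at h
  exact (ENNReal.le_ofReal_iff_toReal_le hf.2.ne hb).2 h

theorem abs_const_mul_absPowDeriv_rpow {p s c : ℝ} (hps : p.HolderConjugate s) (hc : 0 ≤ c)
    (x : ℝ) : |c * absPowDeriv p x| ^ s = c ^ s * |x| ^ p := by
  rw [abs_mul, abs_of_nonneg hc, abs_absPowDeriv hps.lt,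
    Real.mul_rpow hc (Real.rpow_nonneg (abs_nonneg _) _), ← Real.rpow_mul (abs_nonneg _),
    hps.sub_one_mul_conj]

theorem IsTest.memLp_const_mul_absPowDeriv {k : ℕ} (hk : 2 ≤ k) {F : 𝔼 → ℝ} (hF : IsTest k F)
    {c : ℝ} (hc : 0 ≤ c) : MemLp (fun x => c * absPowDeriv (pExp k) (F x))
      (ENNReal.ofReal (sExp k)) volume := by
  have hps := holderConjugate_pExp_sExp hk
  have hm : Measurable fun x => c * absPowDeriv (pExp k) (F x) :=
    ((continuous_absPowDeriv (one_lt_pExp hk)).measurable.comp hF.1).const_mul c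
  rw [← integrable_norm_rpow_iff hm.aestronglyMeasurable (by simpa using hps.symm.pos)
    ENNReal.ofReal_ne_top, ENNReal.toReal_ofReal hps.symm.nonneg]
  simp only [Real.norm_eq_abs, abs_const_mul_absPowDeriv_rpow hps hc]
  exact (MemLp.integrable_abs_rpow (pExp_pos k) hF.memLp).const_mul _

end Decomposition

theorem theorem4 (d k : ℕ) (hk : 2 ≤ k) (δ : ℝ) (hδ : 0 < δ)
    (g : EuclideanSpace ℝ (Fin d) → ℝ)
    (hg : MemLp g (ENNReal.ofReal (sExp k)) volume)
    (hg1 : antiUniformNorm k g = 1) :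
    ∃ F H : EuclideanSpace ℝ (Fin d) → ℝ,
      MemLp F (ENNReal.ofReal (pExp k)) volume ∧
      MemLp H (ENNReal.ofReal (sExp k)) volume ∧
      (∀ᵐ x : EuclideanSpace ℝ (Fin d), Integrable (cubeProd k F x) volume) ∧
      (∀ᵐ x : EuclideanSpace ℝ (Fin d), g x = dualFun k F x + H x) ∧
      gowersNorm k F ≤ 1 ∧
      eLpNorm F (ENNReal.ofReal (pExp k)) volume ≤ ENNReal.ofReal (1 / δ) ∧
      eLpNorm H (ENNReal.ofReal (sExp k)) volume ≤ ENNReal.ofReal δ := by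
  obtain ⟨F, hF, hEL⟩ := exists_eulerLagrange hk hδ hg
  have hps := holderConjugate_pExp_sExp hk
  have hlam : 0 < δ ^ pExp k := by positivity
  obtain ⟨j, rfl⟩ : ∃ j, k = j + 1 := ⟨k - 1, by omega⟩
  have hu := hF.cubeForm_self_nonneg
  have hN : (2 ^ (j + 1) : ℕ) ≠ 0 := by positivity
  -- The `U(k)` norm of `F` as a real number.
  set v : ℝ := cubeForm (j + 1) F F ^ (((2 ^ (j + 1) : ℕ) : ℝ)⁻¹)
  have hv : 0 ≤ v := Real.rpow_nonneg hu _
  have hvu : cubeForm (j + 1) F F = v ^ (2 ^ (j + 1)) := (Real.rpow_inv_natCast_pow hu hN).symm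
  have h1 := hF.integral_mul_le_of_cubeForm_eq hk hg1.le hv hvu
  -- Testing the equation with `F` itself gives `v^(2^k) + δ^p ∫ |F|^p ≤ v`; if `v > 1`, then
  -- `v^(2^k) ≥ v² > v` contradicts it.
  rw [hEL F hF] at h1
  simp only [absPowDeriv_mul_self (one_lt_pExp hk)] at h1
  have hP : 0 ≤ ∫ x, |F x| ^ pExp (j + 1) := integral_nonneg fun x => by positivity
  have hlamP := mul_nonneg hlam.le hP
  have hv1 : v ≤ 1 := by
    by_contra! h
    have h2 : v ^ 2 ≤ v ^ (2 ^ (j + 1)) :=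
      pow_le_pow_right₀ h.le (Nat.le_self_pow (by omega) 2)
    nlinarith
  have hP1 : δ ^ pExp (j + 1) * ∫ x, |F x| ^ pExp (j + 1) ≤ 1 := by linarith
  have hH := hF.memLp_const_mul_absPowDeriv hk hlam.le
  refine ⟨F, fun x => δ ^ pExp (j + 1) * absPowDeriv (pExp (j + 1)) (F x), hF.memLp, hH,
    hF.ae_integrable_cubeProd, ae_eq_dualFun_add hk hg hF hEL, ?_, ?_, ?_⟩
  · rw [← pow_le_one_iff hN, hF.gowersNorm_pow, ENNReal.ofReal_le_one, hvu]
    exact pow_le_one₀ hv hv1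
  · refine eLpNorm_le_of_integral_abs_rpow_le hps.pos (by positivity) hF.memLp ?_
    rw [one_div, Real.inv_rpow hδ.le, ← one_div, le_div_iff₀ hlam, mul_comm]
    exact hP1
  · refine eLpNorm_le_of_integral_abs_rpow_le hps.symm.pos hδ.le hH ?_
    simp only [abs_const_mul_absPowDeriv_rpow hps hlam.le]
    -- Since `p s = p + s`, the integral of `|H|^s` is `δ^s` times the quantity `δ^p ∫ |F|^p ≤ 1`.
    rw [integral_const_mul, ← Real.rpow_mul hδ.le, hps.mul_eq_add, Real.rpow_add hδ,
      mul_comm (δ ^ pExp (j + 1)), mul_assoc]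
    exact mul_le_of_le_one_right (by positivity) hP1
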